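/- Let $d\in\mathbb N=\{1,2,\dots\}$ and let $U_1,U_2,\dots$ be independent random vectors, each uniformly distributed on $(0,1)^d$. The on-line nearest-neighbour graph on $\mathcal U_n=(U_1,\dots,U_n)$ joins each point after the first to its nearest predecessor in the Euclidean norm. For $\alpha>0$ its total power-weighted edge length is $$\mathcal O^{d,\alpha}(\mathcal U_n)=\sum_{i=2}^n \Big(\inf\{\|U_i-y\| : y\in\{U_1,\dots,U_{i-1}\}\setminus\{U_i\}\}\Big)^{\alpha},$$ with $\mathcal O^{d,\alpha}(\mathcal U_0)=\mathcal O^{d,\alpha}(\mathcal U_1)=0$. Let $(N(t))_{t\ge 0}$ be the counting process of a homogeneous Poisson process of unit rate on $(0,\infty)$, independent of $(U_1,U_2,\dots)$, and for $\lambda>0$ put $\mathcal P_\lambda=\mathcal U_{N(\lambda)}$, so that the points of $\mathcal P_\lambda$ form a homogeneous Poisson process of intensity $\lambda$ on $(0,1)^d$. Write $\tilde{\mathcal O}^{d,\alpha}(\cdot)=\mathcal O^{d,\alpha}(\cdot)-\mathbb E[\mathcal O^{d,\alpha}(\cdot)]$. The random variables below are square-integrable, and the following hold. (i) For every $\alpha\in(0,d/2)$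 there is a constant $C\in(0,\infty)$, depending only on $d$ and $\alpha$, such that for all $n\in\mathbb N$ and all real $\lambda\ge 1$, $$\operatorname{Var}[\tilde{\mathcal O}^{d,\alpha}(\mathcal U_n)]\le C\,n^{1-2\alpha/d},\qquad \operatorname{Var}[\tilde{\mathcal O}^{d,\alpha}(\mathcal P_\lambda)]\le C\,\lambda^{1-2\alpha/d}.$$ (ii) There is a constant $C\in(0,\infty)$, depending only on $d$, such that for all $n\in\mathbb N$ and all real $\lambda\ge 1$, $$\operatorname{Var}[\tilde{\mathcal O}^{d,d/2}(\mathcal U_n)]\le C\log(1+n),\qquad \operatorname{Var}[\tilde{\mathcal O}^{d,d/2}(\mathcal P_\lambda)]\le C\log(1+\lambda).$$ -/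

import Mathlib

open MeasureTheory ProbabilityTheory
open scoped NNReal

noncomputable section

namespace OnlineNN

/-- The open unit cube `(0,1)^d` in Euclidean space. -/
def unitCube (d : ℕ) : Set (EuclideanSpace ℝ (Fin d)) :=
  {x | ∀ i, x i ∈ Set.Ioo (0 : ℝ) 1}

/-- `d(x; S)`, the infimum of `‖x - y‖` over `y ∈ S \ {x}`
(with the value `0` if `S \ {x}` is empty). -/
def nnDist {d : ℕ} (x : EuclideanSpace ℝ (Fin d)) (S : Set (EuclideanSpace ℝ (Fin d))) : ℝ :=
  Metric.infDist x (S \ {x})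

/-- The total power-weighted edge length, with weight exponent `α`, of the on-line
nearest-neighbour graph on the first `n` points of the sequence `x 0, x 1, x 2, …`: every point
after the first contributes the `α`-th power of the distance to its nearest predecessor.
It is `0` for `n = 0` and `n = 1`. -/
def totalLength {d : ℕ} (α : ℝ) (x : ℕ → EuclideanSpace ℝ (Fin d)) (n : ℕ) : ℝ :=
  ∑ i ∈ Finset.Ico 1 n, nnDist (x i) (x '' Set.Iio i) ^ α

/-- The centred version `X - 𝔼[X]` of a real random variable. -/
def centred {Ω : Type*} [MeasurableSpace Ω] (P : Measure Ω) (X : Ω → ℝ) : Ω → ℝ :=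
  fun ω => X ω - ∫ ω', X ω' ∂P

/-- `U 0, U 1, …` are independent random vectors, each uniformly distributed on `(0,1)^d`. -/
structure IsUniformSequence {Ω : Type*} [MeasurableSpace Ω] {d : ℕ}
    (U : ℕ → Ω → EuclideanSpace ℝ (Fin d)) (P : Measure Ω) : Prop where
  measurable : ∀ i, Measurable (U i)
  indep : iIndepFun U P
  uniform : ∀ i, pdf.IsUniform (U i) (unitCube d) P volume

/-- `N` is the counting process of a homogeneous Poisson process of unit rate on `(0,∞)`:
almost surely its paths start at `0`, are nondecreasing and right-continuous, and its increments
are independent with `N t - N s` Poisson of mean `t - s`. -/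
structure IsPoissonCountingProcess {Ω : Type*} [MeasurableSpace Ω]
    (N : ℝ≥0 → Ω → ℕ) (P : Measure Ω) : Prop where
  measurable : ∀ t, Measurable (N t)
  zero : ∀ᵐ ω ∂P, N 0 ω = 0
  mono : ∀ᵐ ω ∂P, Monotone fun t => N t ω
  rightCont : ∀ᵐ ω ∂P, ∀ t, ContinuousWithinAt (fun s => N s ω) (Set.Ici t) t
  indepIncrements : HasIndepIncrements N P
  law : ∀ s t, s ≤ t → HasLaw (fun ω => N t ω - N s ω) (poissonMeasure (t - s)) P

/-- `𝒪^{d,α}(𝒰_n)`, the total power-weighted edge length on `U 0, …, U (n - 1)`. -/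
def binomialLength {Ω : Type*} {d : ℕ} (α : ℝ) (U : ℕ → Ω → EuclideanSpace ℝ (Fin d)) (n : ℕ) :
    Ω → ℝ :=
  fun ω => totalLength α (fun i => U i ω) n

/-- `𝒪^{d,α}(𝒫_t)` with `𝒫_t = 𝒰_{N(t)}`. -/
def poissonLength {Ω : Type*} {d : ℕ} (α : ℝ) (U : ℕ → Ω → EuclideanSpace ℝ (Fin d))
    (N : ℝ≥0 → Ω → ℕ) (t : ℝ≥0) : Ω → ℝ :=
  fun ω => totalLength α (fun i => U i ω) (N t ω)

end OnlineNN

end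

noncomputable section

namespace OnlineNN

/-! ### Capped nearest-neighbour distances -/

section CapDist

variable {E : Type*} [PseudoMetricSpace E]

/-- The distance from `y` to the nearest of the points `x l`, `l ∈ S`, capped at `R`. -/
def capDist (R : ℝ) (y : E) (S : Finset ℕ) (x : ℕ → E) : ℝ :=
  S.fold min R fun l => dist y (x l)

lemma le_capDist {R c : ℝ} {y : E} {S : Finset ℕ} {x : ℕ → E} :
    c ≤ capDist R y S x ↔ c ≤ R ∧ ∀ l ∈ S, c ≤ dist y (x l) :=
  Finset.le_fold_min _

lemma capDist_nonneg {R : ℝ} (hR : 0 ≤ R) (y : E) (S : Finset ℕ) (x : ℕ → E) :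
    0 ≤ capDist R y S x :=
  le_capDist.2 ⟨hR, fun _ _ => dist_nonneg⟩

lemma capDist_le (R : ℝ) (y : E) (S : Finset ℕ) (x : ℕ → E) : capDist R y S x ≤ R :=
  (le_capDist.1 le_rfl).1

lemma capDist_le_dist (R : ℝ) (y : E) {S : Finset ℕ} (x : ℕ → E) {l : ℕ} (hl : l ∈ S) :
    capDist R y S x ≤ dist y (x l) :=
  (le_capDist.1 le_rfl).2 l hl

lemma capDist_anti (R : ℝ) (y : E) {S T : Finset ℕ} (h : S ⊆ T) (x : ℕ → E) :
    capDist R y T x ≤ capDist R y S x :=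
  le_capDist.2 ⟨capDist_le .., fun _ hl => capDist_le_dist R y x (h hl)⟩

lemma capDist_congr (R : ℝ) (y : E) {S : Finset ℕ} {x x' : ℕ → E} (h : ∀ l ∈ S, x l = x' l) :
    capDist R y S x = capDist R y S x' :=
  Finset.fold_congr fun l hl => by rw [h l hl]

lemma capDist_insert (R : ℝ) (y : E) {S : Finset ℕ} {i : ℕ} (hi : i ∉ S) (x : ℕ → E) :
    capDist R y (insert i S) x = min (dist y (x i)) (capDist R y S x) :=
  Finset.fold_insert hi

lemma abs_capDist_rpow_sub_le {R α : ℝ} (hR : 0 ≤ R) (hα : 0 < α) (y : E) {S : Finset ℕ} {i : ℕ}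
    (hi : i ∈ S) (x : ℕ → E) :
    |capDist R y S x ^ α - capDist R y (S.erase i) x ^ α| ≤
      if dist y (x i) < capDist R y (S.erase i) x then capDist R y (S.erase i) x ^ α else 0 := by
  have h := capDist_insert R y (Finset.notMem_erase i S) x
  rw [Finset.insert_erase hi] at h
  have h0 := capDist_nonneg hR y (S.erase i) x
  split_ifs with hlt
  · rw [h, min_eq_left hlt.le, abs_sub_comm, abs_of_nonneg]
    · linarith [Real.rpow_nonneg (dist_nonneg (x := y) (y := x i)) α]
    · linarith [Real.rpow_le_rpow dist_nonneg hlt.le hα.le]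
  · rw [h, min_eq_right (not_lt.1 hlt)]; simp

variable [MeasurableSpace E] [SecondCountableTopology E] [OpensMeasurableSpace E]

lemma measurable_capDist (R : ℝ) (S : Finset ℕ) :
    Measurable fun p : E × (ℕ → E) => capDist R p.1 S p.2 := by
  induction S using Finset.induction_on with
  | empty => simp [capDist]
  | insert i S hi ih =>
    simp_rw [capDist_insert R _ hi]
    have h : Measurable fun p : E × (ℕ → E) => dist p.1 (p.2 i) :=
      measurable_fst.dist ((measurable_pi_apply i).comp measurable_snd)
    exact Measurable.min h ih

end CapDist

/-! ### The unit cube -/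

section Cube

variable {d : ℕ}

lemma unitCube_eq (d : ℕ) : unitCube d =
    WithLp.ofLp ⁻¹' (Set.univ.pi fun _ : Fin d => Set.Ioo (0 : ℝ) 1) := by
  ext x; simp [unitCube]

lemma measurableSet_unitCube (d : ℕ) : MeasurableSet (unitCube d) := by
  rw [unitCube_eq]
  exact (PiLp.volume_preserving_ofLp (Fin d)).measurable
    (MeasurableSet.univ_pi fun _ => measurableSet_Ioo)

lemma volume_unitCube (d : ℕ) : volume (unitCube d) = 1 := by
  rw [unitCube_eq, (PiLp.volume_preserving_ofLp (Fin d)).measure_preimage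
    (MeasurableSet.univ_pi fun _ => measurableSet_Ioo).nullMeasurableSet, Real.volume_pi_Ioo]
  simp

lemma dist_le_sqrt_of_mem_unitCube {x y : EuclideanSpace ℝ (Fin d)} (hx : x ∈ unitCube d)
    (hy : y ∈ unitCube d) : dist x y ≤ √d := by
  rw [EuclideanSpace.dist_eq]
  apply Real.sqrt_le_sqrt
  calc ∑ i, dist (x i) (y i) ^ 2 ≤ ∑ _i : Fin d, (1 : ℝ) := by
        refine Finset.sum_le_sum fun i _ => ?_
        have h1 := hx i
        have h2 := hy i
        rw [Real.dist_eq, sq_abs]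
        nlinarith [h1.1, h1.2, h2.1, h2.2]
    _ = d := by simp

lemma volume_unitCube_inter_ball_ge (hd : 1 ≤ d) {y : EuclideanSpace ℝ (Fin d)}
    (hy : y ∈ unitCube d) {r : ℝ} (hr : 0 < r) (hr' : r ≤ √d) :
    ENNReal.ofReal ((r / √d) ^ d) ≤ volume (unitCube d ∩ {z | dist y z < r}) := by
  set h := r / √d with hh
  have hd0 : (0 : ℝ) < √d := Real.sqrt_pos.2 (by exact_mod_cast hd)
  have h0 : 0 < h := div_pos hr hd0
  have h1 : h ≤ 1 := (div_le_one hd0).2 hr'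
  let B : Set (Fin d → ℝ) :=
    Set.univ.pi fun i => Set.Ioo (max 0 (y i - h)) (min 1 (y i + h))
  have hB : MeasurableSet B := MeasurableSet.univ_pi fun _ => measurableSet_Ioo
  have hvol : ENNReal.ofReal (h ^ d) ≤ volume B := by
    rw [Real.volume_pi_Ioo, ← ENNReal.ofReal_prod_of_nonneg]
    · apply ENNReal.ofReal_le_ofReal
      calc h ^ d = ∏ _i : Fin d, h := by simp
        _ ≤ _ := Finset.prod_le_prod (fun _ _ => h0.le) fun i _ => by
          have := hy i
          rcases max_cases 0 (y i - h) with ⟨e, _⟩ | ⟨e, _⟩ <;>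
          rcases min_cases 1 (y i + h) with ⟨e', _⟩ | ⟨e', _⟩ <;> rw [e, e'] <;>
          linarith [this.1, this.2]
    · intro i _
      have := hy i
      rcases max_cases 0 (y i - h) with ⟨e, _⟩ | ⟨e, _⟩ <;>
      rcases min_cases 1 (y i + h) with ⟨e', _⟩ | ⟨e', _⟩ <;> rw [e, e'] <;>
      linarith [this.1, this.2]
  refine hvol.trans ?_
  rw [← (PiLp.volume_preserving_ofLp (Fin d)).measure_preimage
    hB.nullMeasurableSet]
  refine measure_mono fun z hz => ?_
  have hz : ∀ i, z i ∈ Set.Ioo (max 0 (y i - h)) (min 1 (y i + h)) := by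
    simpa [B] using hz
  refine ⟨fun i => ⟨(le_max_left _ _).trans_lt (hz i).1, (hz i).2.trans_le (min_le_left _ _)⟩, ?_⟩
  rw [Set.mem_ofPred_eq, EuclideanSpace.dist_eq, Real.sqrt_lt' hr]
  have hne : (Finset.univ : Finset (Fin d)).Nonempty := ⟨⟨0, hd⟩, Finset.mem_univ _⟩
  calc ∑ i, dist (y i) (z i) ^ 2 < ∑ _i : Fin d, h ^ 2 := by
        refine Finset.sum_lt_sum_of_nonempty hne fun i _ => ?_
        have a := (le_max_right _ _).trans_lt (hz i).1
        have b := (hz i).2.trans_le (min_le_right _ _)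
        rw [Real.dist_eq, sq_lt_sq, abs_abs, abs_of_pos h0, abs_lt]
        constructor <;> linarith
    _ = r ^ 2 := by
        simp only [Finset.sum_const, Finset.card_univ, Fintype.card_fin, nsmul_eq_mul]
        rw [hh, div_pow, Real.sq_sqrt (Nat.cast_nonneg d)]
        have : (d : ℝ) ≠ 0 := by exact_mod_cast (by omega)
        field_simp

end Cube

/-! ### Sums of powers -/

section PowerSums

lemma mul_rpow_neg_le_sub {t : ℝ} (ht : 0 ≤ t) (ht' : t ≤ 1) (i : ℕ) :
    (1 - t) * ((i : ℝ) + 1) ^ (-t) ≤ ((i : ℝ) + 1) ^ (1 - t) - (i : ℝ) ^ (1 - t) := by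
  have hi : (0 : ℝ) < i + 1 := by positivity
  have hb := rpow_one_add_le_one_add_mul_self (s := -1 / ((i : ℝ) + 1)) (p := 1 - t)
    (by rw [le_div_iff₀ hi]; linarith [(Nat.cast_nonneg i : (0 : ℝ) ≤ i)]) (by linarith)
    (by linarith)
  have he : 1 + -1 / ((i : ℝ) + 1) = i / (i + 1) := by field_simp; ring
  rw [he, Real.div_rpow (Nat.cast_nonneg i) hi.le, div_le_iff₀ (by positivity)] at hb
  have h2 : ((i : ℝ) + 1) ^ (1 - t) = (i + 1) * ((i : ℝ) + 1) ^ (-t) := by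
    rw [sub_eq_add_neg, Real.rpow_add hi, Real.rpow_one]
  have h3 : (1 + (1 - t) * (-1 / ((i : ℝ) + 1))) * ((i : ℝ) + 1) ^ (1 - t)
      = ((i : ℝ) + 1) ^ (1 - t) - (1 - t) * ((i : ℝ) + 1) ^ (-t) := by
    rw [h2]; field_simp; ring
  linarith

lemma sum_Ico_rpow_neg_le {t : ℝ} (ht : 0 ≤ t) (ht' : t < 1) {a b : ℕ} (hab : a ≤ b) :
    ∑ i ∈ Finset.Ico a b, ((i : ℝ) + 1) ^ (-t) ≤
      ((b : ℝ) ^ (1 - t) - (a : ℝ) ^ (1 - t)) / (1 - t) := by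
  rw [le_div_iff₀ (by linarith), Finset.sum_mul]
  calc ∑ i ∈ Finset.Ico a b, ((i : ℝ) + 1) ^ (-t) * (1 - t)
      ≤ ∑ i ∈ Finset.Ico a b, (((i + 1 : ℕ) : ℝ) ^ (1 - t) - (i : ℝ) ^ (1 - t)) :=
        Finset.sum_le_sum fun i _ => by
          rw [mul_comm]; push_cast; exact mul_rpow_neg_le_sub ht ht'.le i
    _ = _ := Finset.sum_Ico_sub (fun i : ℕ => (i : ℝ) ^ (1 - t)) hab

lemma sum_Ico_rpow_neg_le_mul {t : ℝ} (ht : 0 ≤ t) (ht' : t < 1) {a b : ℕ} (hab : a ≤ b) :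
    ∑ i ∈ Finset.Ico a b, ((i : ℝ) + 1) ^ (-t) ≤ ((b : ℝ) - a) * (b : ℝ) ^ (-t) / (1 - t) := by
  rcases Nat.eq_zero_or_pos b with rfl | hb
  · obtain rfl : a = 0 := by omega
    simp
  have hb' : (0 : ℝ) < b := by exact_mod_cast hb
  refine (sum_Ico_rpow_neg_le ht ht' hab).trans (div_le_div_of_nonneg_right ?_ (by linarith))
  have h1 : (b : ℝ) ^ (1 - t) = b * (b : ℝ) ^ (-t) := by
    rw [sub_eq_add_neg, Real.rpow_add hb', Real.rpow_one]
  have h2 : (a : ℝ) * (b : ℝ) ^ (-t) ≤ (a : ℝ) ^ (1 - t) := by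
    rcases Nat.eq_zero_or_pos a with rfl | ha
    · simp only [Nat.cast_zero, zero_mul]; positivity
    have ha' : (0 : ℝ) < a := by exact_mod_cast ha
    rw [sub_eq_add_neg, Real.rpow_add ha', Real.rpow_one]
    exact mul_le_mul_of_nonneg_left
      (Real.rpow_le_rpow_of_nonpos ha' (by exact_mod_cast hab) (by linarith)) ha'.le
  rw [h1]; linarith

lemma mul_rpow_neg_one_sub_le {s : ℝ} (hs : 0 < s) (hs' : s ≤ 1) {j : ℕ} (hj : 1 ≤ j) :
    s * ((j : ℝ) + 1) ^ (-1 - s) ≤ (j : ℝ) ^ (-s) - ((j : ℝ) + 1) ^ (-s) := by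
  have hj0 : (0 : ℝ) < j := by exact_mod_cast hj
  have hi : (0 : ℝ) < j + 1 := by positivity
  have hb := rpow_one_add_le_one_add_mul_self (s := -1 / ((j : ℝ) + 1)) (p := s)
    (by rw [le_div_iff₀ hi]; linarith) hs.le hs'
  have he : 1 + -1 / ((j : ℝ) + 1) = j / (j + 1) := by field_simp; ring
  rw [he, Real.div_rpow hj0.le hi.le] at hb
  have hA : 0 < (j : ℝ) ^ s := by positivity
  have hB : 0 < ((j : ℝ) + 1) ^ s := by positivity
  rw [sub_eq_add_neg (-1 : ℝ), Real.rpow_add hi, Real.rpow_neg_one, Real.rpow_neg hj0.le,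
    Real.rpow_neg hi.le]
  set A := (j : ℝ) ^ s
  set B := ((j : ℝ) + 1) ^ s
  set u := ((j : ℝ) + 1)⁻¹ with hu
  have hu0 : 0 < u := by positivity
  have hb' : A ≤ (1 - s * u) * B := by
    rw [div_le_iff₀ hB] at hb
    calc A ≤ _ := hb
      _ = _ := by rw [hu]; ring
  have h1 : A * (1 + s * u) ≤ B := by
    have : A * (1 + s * u) ≤ (1 - s * u) * B * (1 + s * u) :=
      mul_le_mul_of_nonneg_right hb' (by positivity)
    nlinarith [mul_nonneg hB.le (sq_nonneg (s * u))]
  have h2 : B⁻¹ * (1 + s * u) ≤ A⁻¹ := by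
    rw [inv_mul_eq_div, div_le_iff₀ hB, inv_mul_eq_div, le_div_iff₀ hA]; linarith
  linarith

lemma sum_Ioo_rpow_le {s : ℝ} (hs : 0 < s) (hs' : s ≤ 1) (i n : ℕ) :
    ∑ j ∈ Finset.Ioo i n, ((j : ℝ) + 1) ^ (-1 - s) ≤ ((i : ℝ) + 1) ^ (-s) / s := by
  rw [le_div_iff₀ hs, Finset.sum_mul]
  have hI : Finset.Ioo i n = Finset.Ico (i + 1) n := by ext; simp
  rw [hI]
  rcases le_total (i + 1) n with h | h
  · calc ∑ j ∈ Finset.Ico (i + 1) n, ((j : ℝ) + 1) ^ (-1 - s) * s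
        ≤ ∑ j ∈ Finset.Ico (i + 1) n, (-((j + 1 : ℕ) : ℝ) ^ (-s) - -(j : ℝ) ^ (-s)) :=
          Finset.sum_le_sum fun j hj => by
            have := mul_rpow_neg_one_sub_le hs hs' (j := j) (by simp at hj; omega)
            push_cast; linarith
      _ = -(n : ℝ) ^ (-s) - -((i + 1 : ℕ) : ℝ) ^ (-s) :=
          Finset.sum_Ico_sub (fun j : ℕ => -(j : ℝ) ^ (-s)) h
      _ ≤ ((i : ℝ) + 1) ^ (-s) := by
          push_cast
          have : (0 : ℝ) ≤ (n : ℝ) ^ (-s) := by positivity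
          linarith
  · rw [Finset.Ico_eq_empty (by omega)]; simp; positivity

end PowerSums

/-! ### The Efron–Stein inequality -/

section EfronStein

lemma memLp_of_bounded {Ω : Type*} [MeasurableSpace Ω] {μ : Measure Ω} [IsProbabilityMeasure μ]
    {X : Ω → ℝ} (hX : Measurable X) {B : ℝ} (hB : ∀ ω, |X ω| ≤ B) {p : ENNReal} : MemLp X p μ :=
  MemLp.of_bound hX.aestronglyMeasurable B (Filter.Eventually.of_forall hB)

lemma integral_sub_const_sq {Ω : Type*} [MeasurableSpace Ω] {μ : Measure Ω}
    [IsProbabilityMeasure μ] {X : Ω → ℝ} (hX : MemLp X 2 μ) (c : ℝ) :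
    ∫ ω, (X ω - c) ^ 2 ∂μ = variance X μ + (∫ ω, X ω ∂μ - c) ^ 2 := by
  rw [variance_eq_sub hX]
  have h1 : Integrable X μ := hX.integrable (by norm_num)
  have h2 : Integrable (fun ω => X ω ^ 2) μ := hX.integrable_sq
  have : ∀ ω, (X ω - c) ^ 2 = X ω ^ 2 - 2 * c * X ω + c ^ 2 := fun ω => by ring
  simp_rw [this]
  have h3 : Integrable (fun ω => X ω ^ 2 - 2 * c * X ω) μ := h2.sub (h1.const_mul _)
  rw [integral_add h3 (integrable_const _), integral_sub h2 (h1.const_mul _), integral_const_mul]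
  simp
  ring

lemma sq_integral_le {Ω : Type*} [MeasurableSpace Ω] {μ : Measure Ω}
    [IsProbabilityMeasure μ] {X : Ω → ℝ} (hX : MemLp X 2 μ) :
    (∫ ω, X ω ∂μ) ^ 2 ≤ ∫ ω, X ω ^ 2 ∂μ := by
  have := integral_sub_const_sq hX 0
  simp only [sub_zero] at this
  linarith [variance_nonneg X μ]

lemma variance_prod_le {α β : Type*} [MeasurableSpace α] [MeasurableSpace β] {μ : Measure α}
    {ν : Measure β} [IsProbabilityMeasure μ] [IsProbabilityMeasure ν] {F : α × β → ℝ} {h : α → ℝ}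
    {V : β → ℝ} {B : ℝ} (hF : Measurable F) (hFB : ∀ p, |F p| ≤ B) (hh : Measurable h)
    (hhB : ∀ x, |h x| ≤ B) (hV : Integrable V ν)
    (hvar : ∀ y, variance (fun x => F (x, y)) μ ≤ V y) :
    variance F (μ.prod ν) ≤ ∫ y, V y ∂ν + ∫ p, (F p - h p.1) ^ 2 ∂(μ.prod ν) := by
  set c := ∫ x, h x ∂μ with hc
  have hcB : |c| ≤ B := by
    have := norm_integral_le_of_norm_le_const (μ := μ) (f := h) (C := B)
      (Filter.Eventually.of_forall hhB)
    simpa using this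
  have hsq : ∀ {γ : Type _} [MeasurableSpace γ] {ρ : Measure γ} [IsProbabilityMeasure ρ]
      {f : γ → ℝ}, Measurable f → (∀ z, |f z| ≤ B + B) → Integrable (fun z => f z ^ 2) ρ :=
    fun hf hb => (memLp_of_bounded hf hb (p := 2)).integrable_sq
  have i1 : Integrable (fun p => (F p - c) ^ 2) (μ.prod ν) :=
    hsq (hF.sub_const c) fun p => (abs_sub _ _).trans (add_le_add (hFB p) hcB)
  have i2 : Integrable (fun p => (F p - h p.1) ^ 2) (μ.prod ν) :=
    hsq (hF.sub (hh.comp measurable_fst)) fun p =>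
      (abs_sub _ _).trans (add_le_add (hFB p) (hhB _))
  have mF : MemLp F 2 (μ.prod ν) := memLp_of_bounded hF hFB
  have key : ∀ y, ∫ x, (F (x, y) - c) ^ 2 ∂μ ≤ V y + ∫ x, (F (x, y) - h x) ^ 2 ∂μ := by
    intro y
    have hFy : Measurable fun x => F (x, y) := hF.comp measurable_prodMk_right
    have m1 : MemLp (fun x => F (x, y)) 2 μ := memLp_of_bounded hFy fun x => hFB _
    have m2 : MemLp h 2 μ := memLp_of_bounded hh hhB
    rw [integral_sub_const_sq m1]
    refine add_le_add (hvar y) ?_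
    rw [hc, ← integral_sub (m1.integrable (by norm_num)) (m2.integrable (by norm_num))]
    exact sq_integral_le (m1.sub m2)
  calc variance F (μ.prod ν) ≤ ∫ p, (F p - c) ^ 2 ∂(μ.prod ν) := by
        rw [integral_sub_const_sq mF]; linarith [sq_nonneg (∫ p, F p ∂(μ.prod ν) - c)]
    _ = ∫ y, ∫ x, (F (x, y) - c) ^ 2 ∂μ ∂ν := integral_prod_symm _ i1
    _ ≤ ∫ y, (V y + ∫ x, (F (x, y) - h x) ^ 2 ∂μ) ∂ν :=
        integral_mono i1.integral_prod_right (hV.add i2.integral_prod_right) key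
    _ = _ := by
        rw [integral_add hV i2.integral_prod_right, integral_prod_symm _ i2]

/-- The Efron–Stein inequality, with the conditional means replaced by arbitrary functions `h i`
not depending on the `i`-th coordinate. -/
theorem variance_le_sum_integral_sq {E : Type*} [MeasurableSpace E] [MeasurableSingletonClass E]
    {ν : Measure E} [IsProbabilityMeasure ν] {μ : ℕ → Measure (ℕ → E)}
    [∀ n, IsProbabilityMeasure (μ n)] {x₀ : ℕ → E} (hμ0 : μ 0 = Measure.dirac x₀)
    (hμ : ∀ n, μ (n + 1) = ((μ n).prod ν).map fun p => Function.update p.1 n p.2) {B : ℝ} (n : ℕ)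
    {F : (ℕ → E) → ℝ} {h : ℕ → (ℕ → E) → ℝ} (hF : Measurable F) (hFB : ∀ x, |F x| ≤ B)
    (hh : ∀ i, Measurable (h i)) (hhB : ∀ i x, |h i x| ≤ B)
    (hinv : ∀ i x y, h i (Function.update x i y) = h i x) :
    variance F (μ n) ≤ ∑ i ∈ Finset.range n, ∫ x, (F x - h i x) ^ 2 ∂(μ n) := by
  induction n generalizing F h with
  | zero => simp [hμ0, variance_dirac]
  | succ n ih =>
    have hu : Measurable fun p : (ℕ → E) × E => Function.update p.1 n p.2 := measurable_update'
    have hInt : ∀ i, Integrable (fun p : (ℕ → E) × E => (F (Function.update p.1 n p.2) -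
        h i (Function.update p.1 n p.2)) ^ 2) ((μ n).prod ν) := fun i =>
      (memLp_of_bounded (B := B + B) (p := 2) ((hF.comp hu).sub ((hh i).comp hu))
        fun p => (abs_sub _ _).trans (add_le_add (hFB _) (hhB _ _))).integrable_sq
    have hmap : ∀ i, ∫ x, (F x - h i x) ^ 2 ∂(μ (n + 1)) = ∫ p : (ℕ → E) × E,
        (F (Function.update p.1 n p.2) - h i (Function.update p.1 n p.2)) ^ 2 ∂((μ n).prod ν) := by
      intro i
      rw [hμ, integral_map hu.aemeasurable]
      exact ((hF.sub (hh i)).pow_const 2).aestronglyMeasurable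
    have hprod := variance_prod_le (μ := μ n) (ν := ν)
      (F := fun p => F (Function.update p.1 n p.2)) (h := h n)
      (V := fun y => ∑ i ∈ Finset.range n, ∫ x, (F (Function.update x n y) -
        h i (Function.update x n y)) ^ 2 ∂(μ n)) (hF.comp hu) (fun _ => hFB _) (hh n) (hhB n)
      (integrable_finsetSum _ fun i _ => (hInt i).integral_prod_right) (fun y => by
        refine ih (F := fun x => F (Function.update x n y))
          (h := fun i x => h i (Function.update x n y)) (hF.comp (hu.comp measurable_prodMk_right))
          (fun _ => hFB _) (fun i => (hh i).comp (hu.comp measurable_prodMk_right))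
          (fun _ _ => hhB _ _) fun i x z => ?_
        rcases eq_or_ne i n with rfl | hin
        · rw [Function.update_idem]
        · rw [Function.update_comm hin, hinv])
    have hv : variance F (μ (n + 1)) =
        variance (fun p : (ℕ → E) × E => F (Function.update p.1 n p.2)) ((μ n).prod ν) := by
      rw [hμ, variance_map hF.aemeasurable hu.aemeasurable]; rfl
    rw [hv, Finset.sum_range_succ]
    refine hprod.trans (add_le_add (le_of_eq ?_) (le_of_eq ?_))
    · rw [integral_finsetSum _ fun i _ => (hInt i).integral_prod_right]
      exact Finset.sum_congr rfl fun i _ => by rw [hmap, integral_prod_symm _ (hInt i)]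
    · rw [hmap]; simp_rw [hinv]

end EfronStein

/-! ### Independence of disjoint blocks of coordinates -/

section Blocks

/-- The sequence `x` with the terms of index outside `S` replaced by `0`. -/
def mask {E : Type*} [Zero E] (S : Finset ℕ) (x : ℕ → E) : ℕ → E := fun l => if l ∈ S then x l else 0

lemma mask_apply {E : Type*} [Zero E] {S : Finset ℕ} (x : ℕ → E) {l : ℕ} (hl : l ∈ S) :
    mask S x l = x l := if_pos hl

lemma measurable_mask {E : Type*} [Zero E] [MeasurableSpace E] (S : Finset ℕ) :
    Measurable (mask S : (ℕ → E) → ℕ → E) := by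
  refine measurable_pi_lambda _ fun l => ?_
  by_cases hl : l ∈ S <;> simp only [mask, hl, if_true, if_false]
  · exact measurable_pi_apply l
  · exact measurable_const

lemma indepFun_mask {E Ω : Type*} [Zero E] [MeasurableSpace E] [MeasurableSpace Ω] {P : Measure Ω}
    {U : ℕ → Ω → E} (hm : ∀ i, Measurable (U i)) (hU : iIndepFun U P) {S T : Finset ℕ}
    (hST : Disjoint S T) :
    IndepFun (fun ω => mask S fun l => U l ω) (fun ω => mask T fun l => U l ω) P := by
  have hext : ∀ A : Finset ℕ, Measurable fun (v : A → E) (l : ℕ) =>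
      if h : l ∈ A then v ⟨l, h⟩ else 0 := by
    intro A
    refine measurable_pi_lambda _ fun l => ?_
    by_cases hl : l ∈ A <;> simp only [hl, dite_true, dite_false]
    · exact measurable_pi_apply _
    · exact measurable_const
  convert (hU.indepFun_finset S T hST hm).comp (hext S) (hext T) using 1 <;>
  · ext ω l
    simp [mask]

lemma lintegral_mul_le_of_indepFun {Ω α β : Type*} [MeasurableSpace Ω] [MeasurableSpace α]
    [MeasurableSpace β] {P : Measure Ω} [IsProbabilityMeasure P] {X : Ω → α} {Y : Ω → β}
    (hX : Measurable X) (hY : Measurable Y) (hXY : IndepFun X Y P) {f : α → ENNReal}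
    {Ψ : α × β → ENNReal} (hf : Measurable f) (hΨ : Measurable Ψ) {C : ENNReal}
    (h : ∀ᵐ ω ∂P, ∫⁻ ω', Ψ (X ω, Y ω') ∂P ≤ C) :
    ∫⁻ ω, f (X ω) * Ψ (X ω, Y ω) ∂P ≤ (∫⁻ ω, f (X ω) ∂P) * C := by
  have hmap := hXY.map_prod_eq_prod_map_map hX.aemeasurable hY.aemeasurable
  have hm : Measurable fun p : α × β => f p.1 * Ψ p := (hf.comp measurable_fst).mul hΨ
  calc ∫⁻ ω, f (X ω) * Ψ (X ω, Y ω) ∂P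
      = ∫⁻ p, f p.1 * Ψ p ∂(P.map fun ω => (X ω, Y ω)) := by
        rw [lintegral_map hm (hX.prodMk hY)]
    _ = ∫⁻ x, ∫⁻ y, f x * Ψ (x, y) ∂(P.map Y) ∂(P.map X) := by
        rw [hmap, lintegral_prod _ hm.aemeasurable]
    _ = ∫⁻ ω, f (X ω) * ∫⁻ ω', Ψ (X ω, Y ω') ∂P ∂P := by
        rw [lintegral_map hm.lintegral_prod_right' hX]
        refine lintegral_congr fun ω => ?_
        have hΨω : Measurable fun y => Ψ (X ω, y) := hΨ.comp measurable_prodMk_left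
        exact (lintegral_const_mul (f (X ω)) hΨω).trans
          (congrArg (f (X ω) * ·) (lintegral_map (μ := P) hΨω hY))
    _ ≤ ∫⁻ ω, f (X ω) * C ∂P := by
        refine lintegral_mono_ae ?_
        filter_upwards [h] with ω hω
        gcongr
    _ = _ := lintegral_mul_const _ (hf.comp hX)

end Blocks

section Uniform

variable {Ω : Type*} [MeasurableSpace Ω] {P : Measure Ω} {d : ℕ}
  {U : ℕ → Ω → EuclideanSpace ℝ (Fin d)}

lemma IsUniformSequence.map_eq (hU : IsUniformSequence U P) (i : ℕ) :
    P.map (U i) = volume.restrict (unitCube d) := by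
  have := hU.uniform i
  rw [pdf.IsUniform, ProbabilityTheory.cond, volume_unitCube] at this
  simpa using this

lemma IsUniformSequence.measurable_seq (hU : IsUniformSequence U P) :
    Measurable fun ω l => U l ω :=
  measurable_pi_lambda _ hU.measurable

lemma IsUniformSequence.ae_mem (hU : IsUniformSequence U P) :
    ∀ᵐ ω ∂P, ∀ i, U i ω ∈ unitCube d := by
  refine ae_all_iff.2 fun i => ?_
  have : ∀ᵐ x ∂(P.map (U i)), x ∈ unitCube d := by
    rw [hU.map_eq i]
    exact ae_restrict_mem (measurableSet_unitCube d)
  exact ae_of_ae_map (hU.measurable i).aemeasurable this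

variable [IsProbabilityMeasure P]

lemma IsUniformSequence.ae_injective (hd : 1 ≤ d) (hU : IsUniformSequence U P) :
    ∀ᵐ ω ∂P, ∀ i j, i ≠ j → U i ω ≠ U j ω := by
  have : Nonempty (Fin d) := ⟨⟨0, hd⟩⟩
  refine ae_all_iff.2 fun i => ae_all_iff.2 fun j => ?_
  rcases eq_or_ne i j with rfl | hij
  · simp
  have hD : MeasurableSet (Set.diagonal (EuclideanSpace ℝ (Fin d))) := measurableSet_diagonal
  have h0 : P.map (fun ω => (U i ω, U j ω)) (Set.diagonal _) = 0 := by
    rw [(hU.indep.indepFun hij).map_prod_eq_prod_map_map (hU.measurable i).aemeasurable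
      (hU.measurable j).aemeasurable, hU.map_eq, hU.map_eq, Measure.measure_prod_null hD]
    refine Filter.Eventually.of_forall fun x => ?_
    have : Prod.mk x ⁻¹' Set.diagonal (EuclideanSpace ℝ (Fin d)) = {x} := by
      ext y; simp [eq_comm]
    simp [this]
  rw [Measure.map_apply ((hU.measurable i).prodMk (hU.measurable j)) hD] at h0
  filter_upwards [measure_eq_zero_iff_ae_notMem.1 h0] with ω hω _ he
  exact hω he

/-! ### Moments of nearest-neighbour distances -/

lemma IsUniformSequence.measure_le_capDist_le (hd : 1 ≤ d) (hU : IsUniformSequence U P)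
    {y : EuclideanSpace ℝ (Fin d)} (hy : y ∈ unitCube d) (S : Finset ℕ) {r : ℝ} (hr : 0 < r) :
    P {ω | r ≤ capDist (√d) y S fun l => U l ω} ≤
      ENNReal.ofReal (Real.exp 1 * Real.exp (-((S.card + 1 : ℝ) * (r / √d) ^ d))) := by
  have hd0 : (0 : ℝ) < √d := Real.sqrt_pos.2 (by exact_mod_cast hd)
  rcases lt_or_ge (√d) r with hlt | hle
  · have : {ω | r ≤ capDist (√d) y S fun l => U l ω} = ∅ := by
      ext ω
      simpa using (capDist_le (√d) y S fun l => U l ω).trans_lt hlt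
    simp [this]
  set q := (r / √d) ^ d with hq
  have hq0 : 0 ≤ q := by positivity
  have hq1 : q ≤ 1 := pow_le_one₀ (by positivity) ((div_le_one hd0).2 hle)
  have hone : ∀ l, P (U l ⁻¹' {z | r ≤ dist y z}) ≤ ENNReal.ofReal (Real.exp (-q)) := by
    intro l
    have hmeas : MeasurableSet {z : EuclideanSpace ℝ (Fin d) | dist y z < r} :=
      measurableSet_lt (measurable_const.dist measurable_id) measurable_const
    have hc : {z : EuclideanSpace ℝ (Fin d) | r ≤ dist y z} = {z | dist y z < r}ᶜ := by
      ext z; simp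
    rw [hc, Set.preimage_compl, measure_compl (hU.measurable l hmeas) (measure_ne_top _ _),
      measure_univ, ← Measure.map_apply (hU.measurable l) hmeas, hU.map_eq,
      Measure.restrict_apply hmeas, Set.inter_comm]
    calc 1 - volume (unitCube d ∩ {z | dist y z < r}) ≤ 1 - ENNReal.ofReal q :=
          tsub_le_tsub_left (volume_unitCube_inter_ball_ge hd hy hr hle) _
      _ = ENNReal.ofReal (1 - q) := by rw [ENNReal.ofReal_sub _ hq0, ENNReal.ofReal_one]
      _ ≤ _ := ENNReal.ofReal_le_ofReal (by linarith [Real.add_one_le_exp (-q)])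
  have hset : {ω | r ≤ capDist (√d) y S fun l => U l ω} =
      ⋂ l ∈ S, U l ⁻¹' {z | r ≤ dist y z} := by
    ext ω
    simp [le_capDist, hle]
  have hmeas' : MeasurableSet {z : EuclideanSpace ℝ (Fin d) | r ≤ dist y z} :=
    measurableSet_le measurable_const (measurable_const.dist measurable_id)
  rw [hset, hU.indep.meas_biInter fun l _ => ⟨_, hmeas', rfl⟩]
  calc ∏ l ∈ S, P (U l ⁻¹' {z | r ≤ dist y z})
      ≤ ∏ _l ∈ S, ENNReal.ofReal (Real.exp (-q)) := Finset.prod_le_prod' fun l _ => hone l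
    _ = ENNReal.ofReal (Real.exp (-q) ^ S.card) := by
        rw [Finset.prod_const, ENNReal.ofReal_pow (Real.exp_pos _).le]
    _ ≤ _ := by
        apply ENNReal.ofReal_le_ofReal
        rw [← Real.exp_nat_mul, ← Real.exp_add, Real.exp_le_exp]
        linarith

/-- A constant in the moment bound for nearest-neighbour distances. -/
def momentConst (d : ℕ) (p : ℝ) : ℝ :=
  Real.exp 1 * p * ((√d ^ d)⁻¹ ^ (-(p / d)) * (1 / d) * Real.Gamma (p / d))

lemma momentConst_nonneg (d : ℕ) {p : ℝ} (hp : 0 ≤ p) : 0 ≤ momentConst d p := by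
  have : 0 ≤ Real.Gamma (p / d) := Real.Gamma_nonneg_of_nonneg (by positivity)
  unfold momentConst
  positivity

lemma IsUniformSequence.lintegral_capDist_rpow_le (hd : 1 ≤ d) (hU : IsUniformSequence U P)
    {y : EuclideanSpace ℝ (Fin d)} (hy : y ∈ unitCube d) (S : Finset ℕ) {p : ℝ} (hp : 0 < p) :
    ∫⁻ ω, ENNReal.ofReal (capDist (√d) y S (fun l => U l ω) ^ p) ∂P ≤
      ENNReal.ofReal (momentConst d p * (S.card + 1 : ℝ) ^ (-(p / d))) := by
  have hdR : (1 : ℝ) ≤ d := by exact_mod_cast hd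
  have hd0 : (0 : ℝ) < √d := Real.sqrt_pos.2 (by linarith)
  set b : ℝ := (S.card + 1 : ℝ) * (√d ^ d)⁻¹ with hb
  have hb0 : 0 < b := by positivity
  have hm : Measurable fun ω => capDist (√d) y S fun l => U l ω :=
    (measurable_capDist (√d) S).comp (measurable_const.prodMk hU.measurable_seq)
  have hInt : IntegrableOn (fun x : ℝ => x ^ (p - 1) * Real.exp (-b * x ^ (d : ℝ)))
      (Set.Ioi 0) := integrableOn_rpow_mul_exp_neg_mul_rpow (by linarith) (by linarith) hb0
  rw [lintegral_rpow_eq_lintegral_meas_le_mul P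
    (Filter.Eventually.of_forall fun ω => capDist_nonneg hd0.le _ _ _) hm.aemeasurable hp]
  have hstep : ∫⁻ t in Set.Ioi (0 : ℝ), P {ω | t ≤ capDist (√d) y S fun l => U l ω} *
        ENNReal.ofReal (t ^ (p - 1)) ≤
      ENNReal.ofReal (Real.exp 1 * (b ^ (-(p - 1 + 1) / d) * (1 / d) *
        Real.Gamma ((p - 1 + 1) / d))) := by
    rw [← integral_rpow_mul_exp_neg_mul_rpow (by linarith) (by linarith) hb0,
      ← integral_const_mul, ofReal_integral_eq_lintegral_ofReal (hInt.const_mul _)]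
    · refine setLIntegral_mono' measurableSet_Ioi fun t ht => ?_
      have ht : (0 : ℝ) < t := ht
      calc P {ω | t ≤ capDist (√d) y S fun l => U l ω} * ENNReal.ofReal (t ^ (p - 1))
          ≤ ENNReal.ofReal (Real.exp 1 * Real.exp (-((S.card + 1 : ℝ) * (t / √d) ^ d))) *
            ENNReal.ofReal (t ^ (p - 1)) := by
            gcongr
            exact hU.measure_le_capDist_le hd hy S ht
        _ = _ := by
            rw [← ENNReal.ofReal_mul (by positivity)]
            congr 1
            have : -((S.card + 1 : ℝ) * (t / √d) ^ d) = -b * t ^ (d : ℝ) := by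
              rw [hb, Real.rpow_natCast, div_pow]; ring
            rw [this]; ring
    · refine (ae_restrict_mem measurableSet_Ioi).mono fun t ht => ?_
      have ht : (0 : ℝ) < t := ht
      simp only [Pi.zero_apply]
      positivity
  calc _ ≤ ENNReal.ofReal p * _ := mul_le_mul_right hstep _
    _ = _ := by
      rw [← ENNReal.ofReal_mul hp.le, sub_add_cancel, hb, neg_div,
        Real.mul_rpow (by positivity) (by positivity), momentConst]
      congr 1; ring

/-! ### Weights localising a nearest neighbour -/

/-- A weight controlling `e ^ p` when `e` has order of magnitude `t ^ (-1 / d)`. -/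
def radialWeight (d : ℕ) (p t e : ℝ) : ℝ := e ^ p * (1 + t ^ (1 / d : ℝ) * e) ^ (d + 1)

/-- An integrable kernel at scale `t ^ (-1 / d)`. -/
def kernelWeight (d : ℕ) (t z : ℝ) : ℝ := (1 + t ^ (1 / d : ℝ) * z) ^ (-((d : ℝ) + 1))

lemma radialWeight_nonneg {p t e : ℝ} (ht : 0 ≤ t) (he : 0 ≤ e) : 0 ≤ radialWeight d p t e := by
  unfold radialWeight; positivity

lemma kernelWeight_nonneg {t z : ℝ} (ht : 0 ≤ t) (hz : 0 ≤ z) : 0 ≤ kernelWeight d t z := by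
  unfold kernelWeight; positivity

lemma rpow_le_radialWeight_mul_kernelWeight {p t e z : ℝ} (ht : 0 ≤ t) (hz : 0 ≤ z)
    (hze : z ≤ e) : e ^ p ≤ radialWeight d p t e * kernelWeight d t z := by
  have he : 0 ≤ e := hz.trans hze
  have hT : 0 ≤ t ^ (1 / d : ℝ) := by positivity
  rw [radialWeight, kernelWeight, mul_assoc]
  refine le_mul_of_one_le_right (by positivity) ?_
  have hz1 : 0 < 1 + t ^ (1 / d : ℝ) * z := by positivity
  rw [Real.rpow_neg hz1.le, ← div_eq_mul_inv, one_le_div (by positivity),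
    show ((d : ℝ) + 1) = ((d + 1 : ℕ) : ℝ) by push_cast; ring, Real.rpow_natCast]
  gcongr

/-- A constant in the bound for the mean of `radialWeight`. -/
def radialConst (d : ℕ) (p : ℝ) : ℝ :=
  2 ^ d * (momentConst d p * 8 ^ (p / d) + momentConst d (p + (d + 1)) * 8 ^ ((p + (d + 1)) / d))

/-- The total mass of `kernelWeight` at unit scale. -/
def kernelConst (d : ℕ) : ℝ :=
  ∫ z : EuclideanSpace ℝ (Fin d), (1 + ‖z‖) ^ (-((d : ℝ) + 1))

lemma radialConst_nonneg (d : ℕ) {p : ℝ} (hp : 0 ≤ p) : 0 ≤ radialConst d p := by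
  have h1 := momentConst_nonneg d hp
  have h2 := momentConst_nonneg d (show 0 ≤ p + (d + 1) by positivity)
  unfold radialConst
  positivity

lemma kernelConst_nonneg (d : ℕ) : 0 ≤ kernelConst d :=
  integral_nonneg fun z => by positivity

lemma rpow_neg_le_of_le_mul {t m q : ℝ} (ht : 0 < t) (htm : t ≤ 8 * m) (hq : 0 ≤ q) :
    m ^ (-q) ≤ 8 ^ q * t ^ (-q) := by
  have hm : 0 < m := by linarith
  have : (8 : ℝ) ^ q * t ^ (-q) = (t / 8) ^ (-q) := by
    rw [Real.div_rpow ht.le (by norm_num), Real.rpow_neg (by norm_num : (0 : ℝ) ≤ 8)]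
    field_simp
  rw [this]
  exact Real.rpow_le_rpow_of_nonpos (by positivity) (by linarith) (by linarith)

lemma IsUniformSequence.lintegral_radialWeight_le (hd : 1 ≤ d) (hU : IsUniformSequence U P)
    {y : EuclideanSpace ℝ (Fin d)} (hy : y ∈ unitCube d) (S : Finset ℕ) {p : ℝ} (hp : 0 < p)
    {t : ℝ} (ht : 0 < t) (htS : t ≤ 8 * (S.card + 1 : ℝ)) :
    ∫⁻ ω, ENNReal.ofReal (radialWeight d p t (capDist (√d) y S fun l => U l ω)) ∂P ≤
      ENNReal.ofReal (radialConst d p * t ^ (-(p / d))) := by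
  have hdR : (0 : ℝ) < d := by exact_mod_cast hd
  have hm : Measurable fun ω => capDist (√d) y S fun l => U l ω :=
    (measurable_capDist (√d) S).comp (measurable_const.prodMk hU.measurable_seq)
  set p' : ℝ := p + (d + 1) with hp'
  have hp'0 : 0 < p' := by positivity
  have hM := momentConst_nonneg d hp.le
  have hM' := momentConst_nonneg d hp'0.le
  have hc : 0 ≤ t ^ (((d : ℝ) + 1) / d) := by positivity
  have hpt : ∀ e : ℝ, 0 ≤ e →
      radialWeight d p t e ≤ 2 ^ d * (e ^ p + t ^ (((d : ℝ) + 1) / d) * e ^ p') := by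
    intro e he
    have h1 := add_pow_le (zero_le_one (α := ℝ)) (mul_nonneg (Real.rpow_nonneg ht.le (1 / d : ℝ)) he)
      (d + 1)
    rw [Nat.add_sub_cancel, one_pow, mul_pow] at h1
    have h2 : (t ^ (1 / d : ℝ)) ^ (d + 1) = t ^ (((d : ℝ) + 1) / d) := by
      rw [← Real.rpow_natCast, ← Real.rpow_mul ht.le]; congr 1; push_cast; ring
    have h3 : e ^ p * e ^ (d + 1) = e ^ p' := by
      rw [hp', Real.rpow_add_of_nonneg he hp.le (by positivity), ← Real.rpow_natCast]
      push_cast; rfl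
    calc radialWeight d p t e ≤ e ^ p * (2 ^ d * (1 + (t ^ (1 / d : ℝ)) ^ (d + 1) * e ^ (d + 1))) :=
          mul_le_mul_of_nonneg_left h1 (by positivity)
      _ = 2 ^ d * (e ^ p + t ^ (((d : ℝ) + 1) / d) * (e ^ p * e ^ (d + 1))) := by rw [h2]; ring
      _ = _ := by rw [h3]
  have hmono : ∀ q : ℝ, 0 < q →
      ∫⁻ ω, ENNReal.ofReal (capDist (√d) y S (fun l => U l ω) ^ q) ∂P ≤
        ENNReal.ofReal (momentConst d q * (8 ^ (q / d) * t ^ (-(q / d)))) := by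
    intro q hq
    refine (hU.lintegral_capDist_rpow_le hd hy S hq).trans (ENNReal.ofReal_le_ofReal ?_)
    exact mul_le_mul_of_nonneg_left (rpow_neg_le_of_le_mul ht htS (by positivity))
      (momentConst_nonneg d hq.le)
  calc ∫⁻ ω, ENNReal.ofReal (radialWeight d p t (capDist (√d) y S fun l => U l ω)) ∂P
      ≤ ∫⁻ ω, ENNReal.ofReal (2 ^ d) * (ENNReal.ofReal (capDist (√d) y S (fun l => U l ω) ^ p) +
          ENNReal.ofReal (t ^ (((d : ℝ) + 1) / d)) *
            ENNReal.ofReal (capDist (√d) y S (fun l => U l ω) ^ p')) ∂P := by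
        refine lintegral_mono fun ω => ?_
        have he := capDist_nonneg (Real.sqrt_nonneg d) y S fun l => U l ω
        rw [← ENNReal.ofReal_mul hc, ← ENNReal.ofReal_add (by positivity) (by positivity),
          ← ENNReal.ofReal_mul (by positivity)]
        exact ENNReal.ofReal_le_ofReal (hpt _ he)
    _ = ENNReal.ofReal (2 ^ d) * (∫⁻ ω, ENNReal.ofReal (capDist (√d) y S (fun l => U l ω) ^ p) ∂P +
          ENNReal.ofReal (t ^ (((d : ℝ) + 1) / d)) *
            ∫⁻ ω, ENNReal.ofReal (capDist (√d) y S (fun l => U l ω) ^ p') ∂P) := by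
        have m1 : Measurable fun ω => ENNReal.ofReal (capDist (√d) y S (fun l => U l ω) ^ p) :=
          (hm.pow_const p).ennreal_ofReal
        have m2 : Measurable fun ω => ENNReal.ofReal (capDist (√d) y S (fun l => U l ω) ^ p') :=
          (hm.pow_const p').ennreal_ofReal
        have m3 : Measurable fun ω => ENNReal.ofReal (t ^ (((d : ℝ) + 1) / d)) *
            ENNReal.ofReal (capDist (√d) y S (fun l => U l ω) ^ p') := m2.const_mul _
        rw [lintegral_const_mul _ (by fun_prop), lintegral_add_left m1, lintegral_const_mul _ m2]
    _ ≤ ENNReal.ofReal (2 ^ d) * (ENNReal.ofReal (momentConst d p * (8 ^ (p / d) * t ^ (-(p / d)))) +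
          ENNReal.ofReal (t ^ (((d : ℝ) + 1) / d)) *
            ENNReal.ofReal (momentConst d p' * (8 ^ (p' / d) * t ^ (-(p' / d))))) := by
        gcongr
        · exact hmono p hp
        · exact hmono p' hp'0
    _ = _ := by
        rw [← ENNReal.ofReal_mul hc, ← ENNReal.ofReal_add (by positivity) (by positivity),
          ← ENNReal.ofReal_mul (by positivity)]
        congr 1
        have : t ^ (((d : ℝ) + 1) / d) * t ^ (-(p' / d)) = t ^ (-(p / d)) := by
          rw [← Real.rpow_add ht]; congr 1; rw [hp']; field_simp; ring
        rw [radialConst, ← hp', ← this]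
        ring

end Uniform

section Kernel

variable {d : ℕ}

lemma lintegral_kernelWeight_le (hd : 1 ≤ d) (x : EuclideanSpace ℝ (Fin d)) {t : ℝ} (ht : 0 < t) :
    ∫⁻ y, ENNReal.ofReal (kernelWeight d t (dist x y)) ≤ ENNReal.ofReal (kernelConst d * t⁻¹) := by
  have hdR : (0 : ℝ) < d := by exact_mod_cast hd
  set T := t ^ (1 / d : ℝ) with hT
  have hT0 : 0 < T := by positivity
  have hInt : Integrable fun z : EuclideanSpace ℝ (Fin d) => (1 + ‖z‖) ^ (-((d : ℝ) + 1)) :=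
    integrable_one_add_norm (by simp)
  have hTd : T ^ d = t := by
    rw [hT, ← Real.rpow_natCast, ← Real.rpow_mul ht.le, one_div, inv_mul_cancel₀ hdR.ne',
      Real.rpow_one]
  have hsc := Measure.integral_comp_smul (volume : Measure (EuclideanSpace ℝ (Fin d)))
    (fun z => (1 + ‖z‖) ^ (-((d : ℝ) + 1))) T
  rw [finrank_euclideanSpace_fin, hTd, abs_of_pos (by positivity), smul_eq_mul] at hsc
  have h1 : ∫⁻ y, ENNReal.ofReal (kernelWeight d t (dist x y)) =
      ∫⁻ z : EuclideanSpace ℝ (Fin d), ENNReal.ofReal ((1 + ‖T • z‖) ^ (-((d : ℝ) + 1))) := by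
    rw [← lintegral_sub_left_eq_self _ x]
    refine lintegral_congr fun y => ?_
    rw [kernelWeight, norm_smul, Real.norm_of_nonneg hT0.le, dist_eq_norm, sub_sub_cancel]
  rw [h1, ← ofReal_integral_eq_lintegral_ofReal
    ((integrable_comp_smul_iff volume _ hT0.ne').2 hInt)
    (Filter.Eventually.of_forall fun z => by simp only [Pi.zero_apply]; positivity), hsc,
    kernelConst, mul_comm]

lemma IsUniformSequence.lintegral_kernelWeight_le {Ω : Type*} [MeasurableSpace Ω]
    {P : Measure Ω} {U : ℕ → Ω → EuclideanSpace ℝ (Fin d)} (hd : 1 ≤ d) (hU : IsUniformSequence U P)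
    (x : EuclideanSpace ℝ (Fin d)) (j : ℕ) {t : ℝ} (ht : 0 < t) :
    ∫⁻ ω, ENNReal.ofReal (kernelWeight d t (dist x (U j ω))) ∂P ≤
      ENNReal.ofReal (kernelConst d * t⁻¹) := by
  have hm : Measurable fun y : EuclideanSpace ℝ (Fin d) =>
      ENNReal.ofReal (kernelWeight d t (dist x y)) := by
    unfold kernelWeight
    fun_prop
  rw [← lintegral_map hm (hU.measurable j), hU.map_eq]
  exact (setLIntegral_le_lintegral _ _).trans (OnlineNN.lintegral_kernelWeight_le hd x ht)

end Kernel

lemma mask_mask {E : Type*} [Zero E] {S T : Finset ℕ} (h : S ⊆ T) (x : ℕ → E) :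
    mask S (mask T x) = mask S x := by
  ext l
  by_cases hl : l ∈ S
  · simp [mask, hl, h hl]
  · simp [mask, hl]

lemma integral_le_of_lintegral_ofReal_le {Ω : Type*} [MeasurableSpace Ω] {μ : Measure Ω}
    {f : Ω → ℝ} (hf : Measurable f) (h0 : ∀ ω, 0 ≤ f ω) {c : ℝ} (hc : 0 ≤ c)
    (h : ∫⁻ ω, ENNReal.ofReal (f ω) ∂μ ≤ ENNReal.ofReal c) : ∫ ω, f ω ∂μ ≤ c := by
  rw [integral_eq_lintegral_of_nonneg_ae (Filter.Eventually.of_forall h0) hf.aestronglyMeasurable]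
  exact ENNReal.toReal_le_of_le_ofReal hc h

section Functionals

variable {d : ℕ}

/-- `totalLength` with capped distances. -/
def capLength (α : ℝ) (n : ℕ) (x : ℕ → EuclideanSpace ℝ (Fin d)) : ℝ :=
  ∑ j ∈ Finset.Ico 1 n, capDist (√d) (x j) (Finset.range j) x ^ α

/-- `capLength` of the sequence with its `i`-th point deleted. -/
def capLengthErase (α : ℝ) (n i : ℕ) (x : ℕ → EuclideanSpace ℝ (Fin d)) : ℝ :=
  ∑ j ∈ (Finset.Ico 1 n).erase i, capDist (√d) (x j) ((Finset.range j).erase i) x ^ α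

/-- A bound for the change of the `j`-th edge length upon deletion of the `i`-th point. -/
def edgeGain (α : ℝ) (i j : ℕ) (x : ℕ → EuclideanSpace ℝ (Fin d)) : ℝ :=
  if dist (x j) (x i) < capDist (√d) (x j) ((Finset.range j).erase i) x then
    capDist (√d) (x j) ((Finset.range j).erase i) x ^ α else 0

/-- A bound for `edgeGain` that factors conditionally on the `i`-th point. -/
def pairWeight (p t : ℝ) (i j : ℕ) (S : Finset ℕ) (x : ℕ → EuclideanSpace ℝ (Fin d)) : ℝ :=
  radialWeight d p t (capDist (√d) (x j) S x) * kernelWeight d t (dist (x i) (x j))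

lemma measurable_capDist_apply (j : ℕ) (S : Finset ℕ) :
    Measurable fun x : ℕ → EuclideanSpace ℝ (Fin d) => capDist (√d) (x j) S x :=
  (measurable_capDist (√d) S).comp ((measurable_pi_apply j).prodMk measurable_id)

lemma measurable_dist_apply (i j : ℕ) :
    Measurable fun x : ℕ → EuclideanSpace ℝ (Fin d) => dist (x i) (x j) :=
  (measurable_pi_apply i).dist (measurable_pi_apply j)

lemma measurable_capLength (α : ℝ) (n : ℕ) : Measurable (capLength (d := d) α n) :=
  Finset.measurable_fun_sum _ fun j _ => (measurable_capDist_apply j _).pow_const α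

lemma measurable_capLengthErase (α : ℝ) (n i : ℕ) : Measurable (capLengthErase (d := d) α n i) :=
  Finset.measurable_fun_sum _ fun j _ => (measurable_capDist_apply j _).pow_const α

lemma measurable_edgeGain (α : ℝ) (i j : ℕ) : Measurable (edgeGain (d := d) α i j) :=
  Measurable.ite (measurableSet_lt (measurable_dist_apply j i) (measurable_capDist_apply j _))
    ((measurable_capDist_apply j _).pow_const α) measurable_const

lemma measurable_kernelWeight_dist (t : ℝ) (i j : ℕ) :
    Measurable fun x : ℕ → EuclideanSpace ℝ (Fin d) => kernelWeight d t (dist (x i) (x j)) :=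
  (((measurable_dist_apply i j).const_mul _).const_add 1).pow_const _

lemma measurable_radialWeight (p t : ℝ) : Measurable (radialWeight d p t) := by
  unfold radialWeight; fun_prop

lemma measurable_pairWeight (p t : ℝ) (i j : ℕ) (S : Finset ℕ) :
    Measurable (pairWeight (d := d) p t i j S) :=
  ((measurable_radialWeight p t).comp (measurable_capDist_apply j S)).mul
    (measurable_kernelWeight_dist t i j)

lemma capDist_rpow_le {α : ℝ} (hα : 0 ≤ α) (y : EuclideanSpace ℝ (Fin d)) (S : Finset ℕ)
    (x : ℕ → EuclideanSpace ℝ (Fin d)) : capDist (√d) y S x ^ α ≤ √d ^ α :=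
  Real.rpow_le_rpow (capDist_nonneg (Real.sqrt_nonneg _) _ _ _) (capDist_le _ _ _ _) hα

lemma capDist_rpow_nonneg (α : ℝ) (y : EuclideanSpace ℝ (Fin d)) (S : Finset ℕ)
    (x : ℕ → EuclideanSpace ℝ (Fin d)) : 0 ≤ capDist (√d) y S x ^ α :=
  Real.rpow_nonneg (capDist_nonneg (Real.sqrt_nonneg _) _ _ _) α

lemma edgeGain_nonneg (α : ℝ) (i j : ℕ) (x : ℕ → EuclideanSpace ℝ (Fin d)) :
    0 ≤ edgeGain α i j x := by
  unfold edgeGain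
  split_ifs
  · exact capDist_rpow_nonneg ..
  · exact le_rfl

lemma edgeGain_le {α : ℝ} (hα : 0 ≤ α) (i j : ℕ) (x : ℕ → EuclideanSpace ℝ (Fin d)) :
    edgeGain α i j x ≤ √d ^ α := by
  unfold edgeGain
  split_ifs
  · exact capDist_rpow_le hα ..
  · positivity

lemma capLength_nonneg (α : ℝ) (n : ℕ) (x : ℕ → EuclideanSpace ℝ (Fin d)) :
    0 ≤ capLength α n x :=
  Finset.sum_nonneg fun _ _ => capDist_rpow_nonneg ..

lemma capLength_le {α : ℝ} (hα : 0 ≤ α) (n : ℕ) (x : ℕ → EuclideanSpace ℝ (Fin d)) :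
    capLength α n x ≤ √d ^ α * n := by
  calc capLength α n x ≤ ∑ _j ∈ Finset.Ico 1 n, √d ^ α :=
        Finset.sum_le_sum fun _ _ => capDist_rpow_le hα ..
    _ = ((n - 1 : ℕ) : ℝ) * √d ^ α := by simp
    _ ≤ n * √d ^ α := by gcongr; omega
    _ = _ := mul_comm _ _

lemma abs_capLengthErase_le {α : ℝ} (hα : 0 ≤ α) (n i : ℕ) (x : ℕ → EuclideanSpace ℝ (Fin d)) :
    |capLengthErase α n i x| ≤ √d ^ α * n := by
  rw [capLengthErase, abs_of_nonneg (Finset.sum_nonneg fun _ _ => capDist_rpow_nonneg ..)]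
  calc _ ≤ ∑ _j ∈ (Finset.Ico 1 n).erase i, √d ^ α :=
        Finset.sum_le_sum fun _ _ => capDist_rpow_le hα ..
    _ ≤ ∑ _j ∈ Finset.Ico 1 n, √d ^ α :=
        Finset.sum_le_sum_of_subset_of_nonneg (Finset.erase_subset _ _) fun _ _ _ => by positivity
    _ = ((n - 1 : ℕ) : ℝ) * √d ^ α := by simp
    _ ≤ n * √d ^ α := by gcongr; omega
    _ = _ := mul_comm _ _

lemma capLength_mask (α : ℝ) (n : ℕ) (x : ℕ → EuclideanSpace ℝ (Fin d)) :
    capLength α n (mask (Finset.range n) x) = capLength α n x := by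
  refine Finset.sum_congr rfl fun j hj => ?_
  have hjn := (Finset.mem_Ico.1 hj).2
  rw [mask_apply _ (Finset.mem_range.2 hjn)]
  congr 1
  exact capDist_congr _ _ fun l hl => mask_apply _ (by simp at hl ⊢; omega)

lemma capLengthErase_mask (α : ℝ) (n i : ℕ) (x : ℕ → EuclideanSpace ℝ (Fin d)) :
    capLengthErase α n i (mask (Finset.range n) x) = capLengthErase α n i x := by
  refine Finset.sum_congr rfl fun j hj => ?_
  have hjn := (Finset.mem_Ico.1 (Finset.mem_of_mem_erase hj)).2
  rw [mask_apply _ (Finset.mem_range.2 hjn)]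
  congr 1
  exact capDist_congr _ _ fun l hl => mask_apply _ (by simp at hl ⊢; omega)

lemma capLengthErase_update (α : ℝ) (n i : ℕ) (x : ℕ → EuclideanSpace ℝ (Fin d))
    (y : EuclideanSpace ℝ (Fin d)) :
    capLengthErase α n i (Function.update x i y) = capLengthErase α n i x := by
  refine Finset.sum_congr rfl fun j hj => ?_
  rw [Function.update_of_ne (Finset.ne_of_mem_erase hj)]
  congr 1
  exact capDist_congr _ _ fun l hl => Function.update_of_ne (Finset.ne_of_mem_erase hl) _ _

lemma abs_capLength_sub_le {α : ℝ} (hα : 0 < α) (n i : ℕ) (x : ℕ → EuclideanSpace ℝ (Fin d)) :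
    |capLength α n x - capLengthErase α n i x| ≤
      capDist (√d) (x i) (Finset.range i) x ^ α + ∑ j ∈ Finset.Ioo i n, edgeGain α i j x := by
  have hD := capDist_rpow_nonneg α (x i) (Finset.range i) x
  have hsum : ∑ j ∈ (Finset.Ico 1 n).erase i, |capDist (√d) (x j) (Finset.range j) x ^ α -
      capDist (√d) (x j) ((Finset.range j).erase i) x ^ α| ≤
        ∑ j ∈ Finset.Ioo i n, edgeGain α i j x := by
    have hI : Finset.Ioo i n = ((Finset.Ico 1 n).erase i).filter (i < ·) := by
      ext j; simp; omega
    rw [hI, Finset.sum_filter]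
    refine Finset.sum_le_sum fun j hj => ?_
    split_ifs with hij
    · exact abs_capDist_rpow_sub_le (Real.sqrt_nonneg _) hα _ (Finset.mem_range.2 hij) x
    · rw [Finset.erase_eq_of_notMem (by simpa using hij)]; simp
  have hF : |capLength α n x - ∑ j ∈ (Finset.Ico 1 n).erase i,
      capDist (√d) (x j) (Finset.range j) x ^ α| ≤ capDist (√d) (x i) (Finset.range i) x ^ α := by
    by_cases hi : i ∈ Finset.Ico 1 n
    · rw [capLength, ← Finset.add_sum_erase _ _ hi, add_sub_cancel_right, abs_of_nonneg hD]
    · rw [Finset.erase_eq_of_notMem hi, capLength, sub_self, abs_zero]; exact hD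
  calc |capLength α n x - capLengthErase α n i x|
      ≤ |capLength α n x - ∑ j ∈ (Finset.Ico 1 n).erase i,
          capDist (√d) (x j) (Finset.range j) x ^ α| +
        |∑ j ∈ (Finset.Ico 1 n).erase i, capDist (√d) (x j) (Finset.range j) x ^ α -
          capLengthErase α n i x| := abs_sub_le _ _ _
    _ ≤ _ := by
      refine add_le_add hF (le_trans ?_ hsum)
      rw [capLengthErase, ← Finset.sum_sub_distrib]
      exact Finset.abs_sum_le_sum_abs _ _

lemma edgeGain_le_pairWeight {α t : ℝ} (hα : 0 ≤ α) (ht : 0 ≤ t) {i j : ℕ} {S : Finset ℕ}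
    (hS : S ⊆ (Finset.range j).erase i) (x : ℕ → EuclideanSpace ℝ (Fin d)) :
    edgeGain α i j x ≤ pairWeight α t i j S x := by
  have hS' := capDist_anti (√d) (x j) hS x
  have h0 := capDist_nonneg (Real.sqrt_nonneg d) (x j) ((Finset.range j).erase i) x
  unfold edgeGain pairWeight
  split_ifs with h
  · refine (Real.rpow_le_rpow h0 hS' hα).trans
      (rpow_le_radialWeight_mul_kernelWeight ht dist_nonneg ?_)
    rw [dist_comm]
    exact h.le.trans hS'
  · exact mul_nonneg (radialWeight_nonneg ht (h0.trans hS')) (kernelWeight_nonneg ht dist_nonneg)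

lemma edgeGain_sq {α : ℝ} (i j : ℕ) (x : ℕ → EuclideanSpace ℝ (Fin d)) :
    edgeGain α i j x * edgeGain α i j x = edgeGain (2 * α) i j x := by
  have h0 := capDist_nonneg (Real.sqrt_nonneg d) (x j) ((Finset.range j).erase i) x
  unfold edgeGain
  split_ifs with h
  · rw [← pow_two, ← Real.rpow_natCast, ← Real.rpow_mul h0, mul_comm]; rfl
  · simp

end Functionals

section Uniform

variable {Ω : Type*} [MeasurableSpace Ω] {P : Measure Ω} [IsProbabilityMeasure P] {d : ℕ}
  {U : ℕ → Ω → EuclideanSpace ℝ (Fin d)}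

/-- Integrating out the `j`-th point and those in `S`. -/
lemma IsUniformSequence.lintegral_mul_pairWeight_le (hd : 1 ≤ d) (hU : IsUniformSequence U P)
    {A S : Finset ℕ} {i j : ℕ} (hiA : i ∈ A) (hjA : j ∉ A) (hjS : j ∉ S) (hAS : Disjoint A S)
    {f : (ℕ → EuclideanSpace ℝ (Fin d)) → ENNReal} (hf : Measurable f)
    (hfA : ∀ x, f (mask A x) = f x) {p t : ℝ} (hp : 0 < p) (ht : 0 < t)
    (htS : t ≤ 8 * (S.card + 1 : ℝ)) :
    ∫⁻ ω, f (fun l => U l ω) * ENNReal.ofReal (pairWeight p t i j S fun l => U l ω) ∂P ≤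
      (∫⁻ ω, f (fun l => U l ω) ∂P) *
        ENNReal.ofReal (radialConst d p * kernelConst d * t ^ (-1 - p / d)) := by
  have hms : ∀ T : Finset ℕ, Measurable fun ω => mask T fun l => U l ω :=
    fun T => (measurable_mask T).comp hU.measurable_seq
  have hAj : A ⊆ insert j A := Finset.subset_insert _ _
  have hj : j ∈ insert j A := Finset.mem_insert_self _ _
  have hfmask : ∀ x, f (mask (insert j A) x) = f x := fun x => by
    rw [← hfA, mask_mask hAj, hfA]
  have step1 := lintegral_mul_le_of_indepFun (hms (insert j A)) (hms S)
    (indepFun_mask hU.measurable hU.indep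
      (by rw [Finset.disjoint_insert_left]; exact ⟨hjS, hAS⟩))
    (f := fun x => f x * ENNReal.ofReal (kernelWeight d t (dist (x i) (x j))))
    (Ψ := fun q => ENNReal.ofReal (radialWeight d p t (capDist (√d) (q.1 j) S q.2)))
    (hf.mul (measurable_kernelWeight_dist t i j).ennreal_ofReal)
    (((measurable_radialWeight p t).comp ((measurable_capDist (√d) S).comp
      (((measurable_pi_apply j).comp measurable_fst).prodMk measurable_snd))).ennreal_ofReal)
    (C := ENNReal.ofReal (radialConst d p * t ^ (-(p / d)))) (by
      filter_upwards [hU.ae_mem] with ω hω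
      simp_rw [mask_apply _ hj]
      refine le_trans (le_of_eq (lintegral_congr fun ω' => ?_))
        (hU.lintegral_radialWeight_le hd (hω j) S hp ht htS)
      rw [capDist_congr _ _ fun l hl => mask_apply _ hl])
  have step2 := lintegral_mul_le_of_indepFun (hms A) (hms {j})
    (indepFun_mask hU.measurable hU.indep (by simpa using hjA)) (f := f)
    (Ψ := fun q => ENNReal.ofReal (kernelWeight d t (dist (q.1 i) (q.2 j)))) hf
    ((((((measurable_pi_apply i).comp measurable_fst).dist
      ((measurable_pi_apply j).comp measurable_snd)).const_mul _).const_add 1).pow_const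
        _).ennreal_ofReal
    (C := ENNReal.ofReal (kernelConst d * t⁻¹)) (by
      refine Filter.Eventually.of_forall fun ω => ?_
      simp_rw [mask_apply _ (Finset.mem_singleton_self j)]
      exact hU.lintegral_kernelWeight_le hd _ j ht)
  simp only [mask_apply _ hj, mask_apply _ (hAj hiA), mask_apply _ hiA, hfmask, hfA,
    mask_apply _ (Finset.mem_singleton_self j)] at step1 step2
  have hR := radialConst_nonneg d hp.le
  have hK := kernelConst_nonneg d
  calc _ = ∫⁻ ω, f (fun l => U l ω) * ENNReal.ofReal (kernelWeight d t (dist (U i ω) (U j ω))) *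
        ENNReal.ofReal (radialWeight d p t (capDist (√d) (U j ω) S
          (mask S fun l => U l ω))) ∂P := by
        refine lintegral_congr fun ω => ?_
        rw [capDist_congr _ _ fun l hl => mask_apply (fun l => U l ω) hl, pairWeight,
          ENNReal.ofReal_mul (radialWeight_nonneg ht.le (capDist_nonneg (Real.sqrt_nonneg _) _ _ _))]
        ring
    _ ≤ _ := step1
    _ ≤ _ := mul_le_mul_left step2 _
    _ = _ := by
        rw [mul_assoc, ← ENNReal.ofReal_mul (by positivity)]
        congr 2
        rw [show -1 - p / d = -1 + -(p / d) by ring, Real.rpow_add ht, Real.rpow_neg_one]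
        ring

lemma card_range_half_erase (i j : ℕ) (hij : i < j) :
    ((j : ℝ) + 1) ≤ 8 * ((((Finset.range (j / 2)).erase i).card : ℝ) + 1) := by
  have := Finset.pred_card_le_card_erase (s := Finset.range (j / 2)) (a := i)
  rw [Finset.card_range] at this
  have h : j + 1 ≤ 8 * (((Finset.range (j / 2)).erase i).card + 1) := by omega
  exact_mod_cast h

lemma card_Ico_half_erase (i j k : ℕ) (hjk : j < k) :
    ((k : ℝ) + 1) ≤ 8 * (((((Finset.Ico (j / 2) k).erase i).erase j).card : ℝ) + 1) := by
  have h1 := Finset.pred_card_le_card_erase (s := Finset.Ico (j / 2) k) (a := i)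
  have h2 := Finset.pred_card_le_card_erase (s := (Finset.Ico (j / 2) k).erase i) (a := j)
  rw [Nat.card_Ico] at h1
  have h : k + 1 ≤ 8 * ((((Finset.Ico (j / 2) k).erase i).erase j).card + 1) := by omega
  exact_mod_cast h

/-- The constant in the bounds for the mean of `pairWeight`. -/
def pairConst (d : ℕ) (p : ℝ) : ℝ := radialConst d p * kernelConst d

lemma pairConst_nonneg (d : ℕ) {p : ℝ} (hp : 0 ≤ p) : 0 ≤ pairConst d p :=
  mul_nonneg (radialConst_nonneg d hp) (kernelConst_nonneg d)

lemma IsUniformSequence.lintegral_pairWeight_le (hd : 1 ≤ d) (hU : IsUniformSequence U P)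
    {S : Finset ℕ} {i j : ℕ} (hij : i ≠ j) (hiS : i ∉ S) (hjS : j ∉ S) {p t : ℝ} (hp : 0 < p)
    (ht : 0 < t) (htS : t ≤ 8 * (S.card + 1 : ℝ)) :
    ∫⁻ ω, ENNReal.ofReal (pairWeight p t i j S fun l => U l ω) ∂P ≤
        ENNReal.ofReal (pairConst d p * t ^ (-1 - p / d)) := by
  have := hU.lintegral_mul_pairWeight_le hd (A := {i}) (S := S) (i := i) (j := j) (by simp)
    (by simpa using hij.symm) hjS (by simpa using hiS) (f := fun _ => 1) measurable_const
    (fun _ => rfl) hp ht htS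
  simpa [pairConst] using this

lemma IsUniformSequence.integral_edgeGain_le (hd : 1 ≤ d) (hU : IsUniformSequence U P)
    {i j : ℕ} (hij : i < j) {p : ℝ} (hp : 0 < p) :
    ∫ ω, edgeGain p i j (fun l => U l ω) ∂P ≤ pairConst d p * ((j : ℝ) + 1) ^ (-1 - p / d) := by
  have hC := pairConst_nonneg d hp.le
  refine integral_le_of_lintegral_ofReal_le ((measurable_edgeGain p i j).comp hU.measurable_seq)
    (fun _ => edgeGain_nonneg ..) (by positivity) ?_
  refine le_trans (lintegral_mono fun ω => ENNReal.ofReal_le_ofReal ?_)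
    (hU.lintegral_pairWeight_le hd hij.ne (S := (Finset.range (j / 2)).erase i) (by simp)
      (by simp; omega) hp (by positivity) (card_range_half_erase i j hij))
  refine edgeGain_le_pairWeight hp.le (by positivity) (Finset.erase_subset_erase _ fun l hl => ?_) _
  simp at hl ⊢; omega

lemma IsUniformSequence.integral_edgeGain_mul_le (hd : 1 ≤ d) (hU : IsUniformSequence U P)
    {i j k : ℕ} (hij : i < j) (hjk : j < k) {p : ℝ} (hp : 0 < p) :
    ∫ ω, edgeGain p i j (fun l => U l ω) * edgeGain p i k (fun l => U l ω) ∂P ≤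
      pairConst d p * ((j : ℝ) + 1) ^ (-1 - p / d) *
        (pairConst d p * ((k : ℝ) + 1) ^ (-1 - p / d)) := by
  have hC := pairConst_nonneg d hp.le
  set S := (Finset.range (j / 2)).erase i
  set S' := ((Finset.Ico (j / 2) k).erase i).erase j
  have hkt : (0 : ℝ) < (k : ℝ) + 1 := by positivity
  have hjt : (0 : ℝ) < (j : ℝ) + 1 := by positivity
  have hw0 : ∀ {t : ℝ} {a b : ℕ} {T : Finset ℕ} (x : ℕ → EuclideanSpace ℝ (Fin d)), 0 ≤ t →
      0 ≤ pairWeight p t a b T x := fun x ht =>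
    mul_nonneg (radialWeight_nonneg ht (capDist_nonneg (Real.sqrt_nonneg _) _ _ _))
      (kernelWeight_nonneg ht dist_nonneg)
  refine integral_le_of_lintegral_ofReal_le
    (((measurable_edgeGain p i j).comp hU.measurable_seq).mul
      ((measurable_edgeGain p i k).comp hU.measurable_seq))
    (fun _ => mul_nonneg (edgeGain_nonneg ..) (edgeGain_nonneg ..)) (by positivity) ?_
  have hpeel := hU.lintegral_mul_pairWeight_le hd (A := insert i (insert k S')) (S := S) (i := i)
    (j := j) (by simp) (by simp [S']; omega) (by simp [S]; omega) (by
      rw [Finset.disjoint_left]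
      intro l
      simp only [Finset.mem_insert, S, S', Finset.mem_erase, Finset.mem_Ico, Finset.mem_range]
      omega)
    (f := fun x => ENNReal.ofReal (pairWeight p ((k : ℝ) + 1) i k S' x))
    (measurable_pairWeight _ _ _ _ _).ennreal_ofReal (fun x => by
      rw [pairWeight, pairWeight, mask_apply x (l := i) (by simp), mask_apply x (l := k) (by simp),
        capDist_congr _ _ fun l hl => mask_apply x (by simp [hl])])
    hp hjt (card_range_half_erase i j hij)
  have hsingle := hU.lintegral_pairWeight_le hd (hij.trans hjk).ne (S := S') (by simp [S'])
    (by simp [S']) hp hkt (card_Ico_half_erase i j k hjk)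
  calc ∫⁻ ω, ENNReal.ofReal (edgeGain p i j (fun l => U l ω) * edgeGain p i k fun l => U l ω) ∂P
      ≤ ∫⁻ ω, ENNReal.ofReal (pairWeight p ((k : ℝ) + 1) i k S' fun l => U l ω) *
          ENNReal.ofReal (pairWeight p ((j : ℝ) + 1) i j S fun l => U l ω) ∂P := by
        refine lintegral_mono fun ω => ?_
        rw [← ENNReal.ofReal_mul (hw0 _ hkt.le), mul_comm]
        refine ENNReal.ofReal_le_ofReal (mul_le_mul (edgeGain_le_pairWeight hp.le hkt.le ?_ _)
          (edgeGain_le_pairWeight hp.le hjt.le ?_ _) (edgeGain_nonneg ..) (hw0 _ hkt.le))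
        · intro l hl
          simp only [S', Finset.mem_erase, Finset.mem_Ico, Finset.mem_range] at hl ⊢; omega
        · intro l hl
          simp only [S, Finset.mem_erase, Finset.mem_range] at hl ⊢; omega
    _ ≤ _ := hpeel
    _ ≤ _ := mul_le_mul_left hsingle _
    _ = _ := by
        rw [← ENNReal.ofReal_mul (by positivity), mul_comm]; rfl

lemma IsUniformSequence.integral_capDist_rpow_le (hd : 1 ≤ d) (hU : IsUniformSequence U P)
    (i : ℕ) {p : ℝ} (hp : 0 < p) :
    ∫ ω, capDist (√d) (U i ω) (Finset.range i) (fun l => U l ω) ^ p ∂P ≤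
      momentConst d p * ((i : ℝ) + 1) ^ (-(p / d)) := by
  have hC := momentConst_nonneg d hp.le
  have hms : ∀ T : Finset ℕ, Measurable fun ω => mask T fun l => U l ω :=
    fun T => (measurable_mask T).comp hU.measurable_seq
  refine integral_le_of_lintegral_ofReal_le
    (((measurable_capDist_apply i _).pow_const p).comp hU.measurable_seq)
    (fun _ => capDist_rpow_nonneg ..) (by positivity) ?_
  have step := lintegral_mul_le_of_indepFun (hU.measurable i) (hms (Finset.range i))
    ((indepFun_mask hU.measurable hU.indep (S := {i}) (T := Finset.range i) (by simp)).comp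
      (measurable_pi_apply i) measurable_id |>.congr (Filter.Eventually.of_forall fun ω => by
        simp [mask]) (Filter.Eventually.of_forall fun ω => rfl)) (f := fun _ => 1)
    (Ψ := fun q => ENNReal.ofReal (capDist (√d) q.1 (Finset.range i) q.2 ^ p)) measurable_const
    ((measurable_capDist (√d) _).pow_const p).ennreal_ofReal
    (C := ENNReal.ofReal (momentConst d p * ((i : ℝ) + 1) ^ (-(p / d)))) (by
      filter_upwards [hU.ae_mem] with ω hω
      refine le_trans (le_of_eq (lintegral_congr fun ω' => ?_))
        ((hU.lintegral_capDist_rpow_le hd (hω i) (Finset.range i) hp).trans_eq (by simp))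
      rw [capDist_congr _ _ fun l hl => mask_apply _ hl])
  simp only [one_mul, lintegral_const, measure_univ] at step
  refine le_trans (le_of_eq (lintegral_congr fun ω => ?_)) step
  rw [capDist_congr _ _ fun l hl => mask_apply (fun l => U l ω) hl]
  rfl

end Uniform

/-! ### The variance for a fixed number of points -/

section Variance

variable {Ω : Type*} [MeasurableSpace Ω] {P : Measure Ω} [IsProbabilityMeasure P] {d : ℕ}
  {U : ℕ → Ω → EuclideanSpace ℝ (Fin d)}

lemma IsUniformSequence.map_mask_succ (hU : IsUniformSequence U P) (n : ℕ) :
    P.map (fun ω => mask (Finset.range (n + 1)) fun l => U l ω) =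
      ((P.map fun ω => mask (Finset.range n) fun l => U l ω).prod (P.map (U 0))).map
        fun p => Function.update p.1 n p.2 := by
  have hm : Measurable fun ω => mask (Finset.range n) fun l => U l ω :=
    (measurable_mask _).comp hU.measurable_seq
  have hind : IndepFun (fun ω => mask (Finset.range n) fun l => U l ω) (U n) P :=
    ((indepFun_mask hU.measurable hU.indep (S := Finset.range n) (T := {n}) (by simp)).comp
      measurable_id (measurable_pi_apply n)).congr (Filter.Eventually.of_forall fun ω => rfl)
      (Filter.Eventually.of_forall fun ω => by simp [mask])
  rw [hU.map_eq 0, ← hU.map_eq n,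
    ← hind.map_prod_eq_prod_map_map hm.aemeasurable (hU.measurable n).aemeasurable,
    Measure.map_map measurable_update' (hm.prodMk (hU.measurable n))]
  congr 1
  ext1 ω
  ext1 l
  rcases lt_trichotomy l n with h | h | h
  · simp [mask, Function.update_of_ne h.ne, h, h.trans (Nat.lt_succ_self n)]
  · subst h; simp [mask]
  · simp only [Function.comp, Function.update_of_ne h.ne', mask, Finset.mem_range]
    rw [if_neg (by omega), if_neg (by omega)]

lemma IsUniformSequence.variance_le_sum (hU : IsUniformSequence U P) (n : ℕ) {B : ℝ}
    {F : (ℕ → EuclideanSpace ℝ (Fin d)) → ℝ} {h : ℕ → (ℕ → EuclideanSpace ℝ (Fin d)) → ℝ}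
    (hF : Measurable F) (hFB : ∀ x, |F x| ≤ B) (hh : ∀ i, Measurable (h i))
    (hhB : ∀ i x, |h i x| ≤ B) (hinv : ∀ i x y, h i (Function.update x i y) = h i x)
    (hFm : ∀ x, F (mask (Finset.range n) x) = F x)
    (hhm : ∀ i x, h i (mask (Finset.range n) x) = h i x) :
    variance (fun ω => F fun l => U l ω) P ≤
      ∑ i ∈ Finset.range n, ∫ ω, (F (fun l => U l ω) - h i fun l => U l ω) ^ 2 ∂P := by
  have hm : ∀ n, Measurable fun ω => mask (Finset.range n) fun l => U l ω :=
    fun n => (measurable_mask _).comp hU.measurable_seq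
  have : ∀ n, IsProbabilityMeasure (P.map fun ω => mask (Finset.range n) fun l => U l ω) :=
    fun n => Measure.isProbabilityMeasure_map (hm n).aemeasurable
  have : IsProbabilityMeasure (P.map (U 0)) :=
    Measure.isProbabilityMeasure_map (hU.measurable 0).aemeasurable
  have h0 : (P.map fun ω => mask (Finset.range 0) fun l => U l ω) = Measure.dirac 0 := by
    have : (fun ω => mask (Finset.range 0) fun l => U l ω) = fun _ => 0 := by
      ext1 ω; ext1 l; simp [mask]
    rw [this, Measure.map_const, measure_univ, one_smul]
  have hES := variance_le_sum_integral_sq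
    (μ := fun n => P.map fun ω => mask (Finset.range n) fun l => U l ω) h0 hU.map_mask_succ n hF
    hFB hh hhB hinv
  rw [variance_map hF.aemeasurable (hm n).aemeasurable] at hES
  refine le_trans (le_of_eq ?_) (hES.trans (le_of_eq (Finset.sum_congr rfl fun i _ => ?_)))
  · congr 1; ext1 ω; exact (hFm _).symm
  · have hsq : Measurable fun x => (F x - h i x) ^ 2 := (hF.sub (hh i)).pow_const 2
    rw [integral_map (hm n).aemeasurable hsq.aestronglyMeasurable]
    simp_rw [hFm, hhm]

/-- The constant in the bound for the mean square effect of deleting a point. -/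
def deletionConst (d : ℕ) (α : ℝ) : ℝ :=
  2 * momentConst d (2 * α) +
    2 * ((pairConst d α / (α / d)) ^ 2 + pairConst d (2 * α) / (2 * α / d))

lemma deletionConst_nonneg (d : ℕ) {α : ℝ} (hα : 0 ≤ α) : 0 ≤ deletionConst d α := by
  have h1 := momentConst_nonneg d (show 0 ≤ 2 * α by positivity)
  have h2 := pairConst_nonneg d (show 0 ≤ 2 * α by positivity)
  unfold deletionConst
  positivity

lemma IsUniformSequence.integral_sq_sum_edgeGain_le (hd : 1 ≤ d) (hU : IsUniformSequence U P)
    {α : ℝ} (hα : 0 < α) (hαd : α ≤ d / 2) (n i : ℕ) :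
    ∫ ω, (∑ j ∈ Finset.Ioo i n, edgeGain α i j fun l => U l ω) ^ 2 ∂P ≤
      ((pairConst d α / (α / d)) ^ 2 + pairConst d (2 * α) / (2 * α / d)) *
        ((i : ℝ) + 1) ^ (-(2 * α / d)) := by
  have hdR : (0 : ℝ) < d := by exact_mod_cast hd
  set s := α / d with hs
  have hs0 : 0 < s := by positivity
  have hs1 : 2 * s ≤ 1 := by
    rw [hs, ← mul_div_assoc, div_le_one hdR]; linarith
  have h2s : 2 * α / d = 2 * s := by rw [hs]; ring
  rw [h2s]
  set G := pairConst d α with hG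
  set G₂ := pairConst d (2 * α) with hG₂
  have hG0 : 0 ≤ G := pairConst_nonneg d hα.le
  have hG20 : 0 ≤ G₂ := pairConst_nonneg d (by positivity)
  have hB : ∀ j k, Integrable (fun ω => edgeGain α i j (fun l => U l ω) *
      edgeGain α i k fun l => U l ω) P := fun j k =>
    (memLp_of_bounded (B := √d ^ α * √d ^ α) (p := 1)
      (((measurable_edgeGain α i j).comp hU.measurable_seq).mul
        ((measurable_edgeGain α i k).comp hU.measurable_seq)) fun ω => by
      rw [Pi.mul_apply, Function.comp_apply, Function.comp_apply,
        abs_of_nonneg (mul_nonneg (edgeGain_nonneg ..) (edgeGain_nonneg ..))]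
      exact mul_le_mul (edgeGain_le hα.le ..) (edgeGain_le hα.le ..) (edgeGain_nonneg ..)
        (by positivity)).integrable le_rfl
  have hterm : ∀ j ∈ Finset.Ioo i n, ∀ k ∈ Finset.Ioo i n,
      ∫ ω, edgeGain α i j (fun l => U l ω) * edgeGain α i k (fun l => U l ω) ∂P ≤
        G * ((j : ℝ) + 1) ^ (-1 - s) * (G * ((k : ℝ) + 1) ^ (-1 - s)) +
          if j = k then G₂ * ((j : ℝ) + 1) ^ (-1 - 2 * s) else 0 := by
    intro j hj k hk
    have hij := (Finset.mem_Ioo.1 hj).1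
    have hik := (Finset.mem_Ioo.1 hk).1
    rcases lt_trichotomy j k with h | h | h
    · rw [if_neg h.ne, add_zero]
      exact hU.integral_edgeGain_mul_le hd hij h hα
    · subst h
      rw [if_pos rfl]
      simp_rw [edgeGain_sq]
      have := hU.integral_edgeGain_le hd hij (p := 2 * α) (by positivity)
      rw [h2s] at this
      refine this.trans (le_add_of_nonneg_left (by positivity))
    · rw [if_neg h.ne', add_zero, mul_comm (G * _)]
      simp_rw [mul_comm (edgeGain α i j _)]
      exact hU.integral_edgeGain_mul_le hd hik h hα
  have hS := sum_Ioo_rpow_le hs0 (by linarith) i n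
  have hS2 := sum_Ioo_rpow_le (s := 2 * s) (by positivity) hs1 i n
  have hS0 : 0 ≤ ∑ j ∈ Finset.Ioo i n, ((j : ℝ) + 1) ^ (-1 - s) :=
    Finset.sum_nonneg fun _ _ => by positivity
  calc ∫ ω, (∑ j ∈ Finset.Ioo i n, edgeGain α i j fun l => U l ω) ^ 2 ∂P
      = ∑ j ∈ Finset.Ioo i n, ∑ k ∈ Finset.Ioo i n,
          ∫ ω, edgeGain α i j (fun l => U l ω) * edgeGain α i k (fun l => U l ω) ∂P := by
        simp_rw [pow_two, Finset.sum_mul_sum]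
        rw [integral_finsetSum _ fun j _ => integrable_finsetSum _ fun k _ => hB j k]
        exact Finset.sum_congr rfl fun j _ => integral_finsetSum _ fun k _ => hB j k
    _ ≤ ∑ j ∈ Finset.Ioo i n, ∑ k ∈ Finset.Ioo i n,
        (G * ((j : ℝ) + 1) ^ (-1 - s) * (G * ((k : ℝ) + 1) ^ (-1 - s)) +
          if j = k then G₂ * ((j : ℝ) + 1) ^ (-1 - 2 * s) else 0) :=
        Finset.sum_le_sum fun j hj => Finset.sum_le_sum fun k hk => hterm j hj k hk
    _ = (G * ∑ j ∈ Finset.Ioo i n, ((j : ℝ) + 1) ^ (-1 - s)) ^ 2 +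
          G₂ * ∑ j ∈ Finset.Ioo i n, ((j : ℝ) + 1) ^ (-1 - 2 * s) := by
        simp_rw [Finset.sum_add_distrib]
        congr 1
        · rw [← Finset.sum_mul_sum, ← Finset.mul_sum, pow_two]
        · rw [Finset.mul_sum]
          refine Finset.sum_congr rfl fun j hj => ?_
          rw [Finset.sum_ite_eq, if_pos hj]
    _ ≤ (G * (((i : ℝ) + 1) ^ (-s) / s)) ^ 2 + G₂ * (((i : ℝ) + 1) ^ (-(2 * s)) / (2 * s)) := by
        gcongr
    _ = _ := by
        have : ((i : ℝ) + 1) ^ (-(2 * s)) = (((i : ℝ) + 1) ^ (-s)) ^ 2 := by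
          rw [← Real.rpow_natCast, ← Real.rpow_mul (by positivity)]; congr 1; push_cast; ring
        rw [this]; field_simp

lemma IsUniformSequence.integral_sq_deletion_le (hd : 1 ≤ d) (hU : IsUniformSequence U P)
    {α : ℝ} (hα : 0 < α) (hαd : α ≤ d / 2) (n i : ℕ) :
    ∫ ω, (capLength α n (fun l => U l ω) - capLengthErase α n i fun l => U l ω) ^ 2 ∂P ≤
      deletionConst d α * ((i : ℝ) + 1) ^ (-(2 * α / d)) := by
  have hsumle : ∀ x : ℕ → EuclideanSpace ℝ (Fin d),
      |∑ j ∈ Finset.Ioo i n, edgeGain α i j x| ≤ ∑ j ∈ Finset.Ioo i n, √d ^ α := fun x => by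
    rw [abs_of_nonneg (Finset.sum_nonneg fun _ _ => edgeGain_nonneg ..)]
    exact Finset.sum_le_sum fun j _ => edgeGain_le hα.le ..
  have i1 : Integrable (fun ω => capDist (√d) (U i ω) (Finset.range i) (fun l => U l ω) ^ (2 * α))
      P := (memLp_of_bounded (B := √d ^ (2 * α)) (p := 1)
      (((measurable_capDist_apply i _).pow_const (2 * α)).comp hU.measurable_seq) fun ω => by
        have := capDist_rpow_le (show 0 ≤ 2 * α by positivity) (U i ω) (Finset.range i)
          fun l => U l ω
        simpa [abs_of_nonneg (capDist_rpow_nonneg ..)] using this).integrable le_rfl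
  have i2 : Integrable (fun ω => (∑ j ∈ Finset.Ioo i n, edgeGain α i j fun l => U l ω) ^ 2) P :=
    (memLp_of_bounded (p := 2) (Finset.measurable_fun_sum _ fun j _ =>
      (measurable_edgeGain α i j).comp hU.measurable_seq) fun ω => hsumle _).integrable_sq
  have hpt : ∀ x : ℕ → EuclideanSpace ℝ (Fin d),
      (capLength α n x - capLengthErase α n i x) ^ 2 ≤
        2 * capDist (√d) (x i) (Finset.range i) x ^ (2 * α) +
          2 * (∑ j ∈ Finset.Ioo i n, edgeGain α i j x) ^ 2 := by
    intro x
    have h0 := capDist_nonneg (Real.sqrt_nonneg d) (x i) (Finset.range i) x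
    have e : capDist (√d) (x i) (Finset.range i) x ^ (2 * α) =
        (capDist (√d) (x i) (Finset.range i) x ^ α) ^ 2 := by
      rw [← Real.rpow_natCast, ← Real.rpow_mul h0, mul_comm]; rfl
    have h := abs_capLength_sub_le hα n i x
    rw [e, ← sq_abs]
    set a := capDist (√d) (x i) (Finset.range i) x ^ α
    set b := ∑ j ∈ Finset.Ioo i n, edgeGain α i j x
    calc _ ≤ (a + b) ^ 2 := pow_le_pow_left₀ (abs_nonneg _) h 2
      _ ≤ _ := by nlinarith [sq_nonneg (a - b)]
  calc _ ≤ ∫ ω, (2 * capDist (√d) (U i ω) (Finset.range i) (fun l => U l ω) ^ (2 * α) +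
          2 * (∑ j ∈ Finset.Ioo i n, edgeGain α i j fun l => U l ω) ^ 2) ∂P := by
        refine integral_mono_of_nonneg (Filter.Eventually.of_forall fun ω => sq_nonneg _)
          ((i1.const_mul 2).add (i2.const_mul 2)) (Filter.Eventually.of_forall fun ω => hpt _)
    _ = 2 * ∫ ω, capDist (√d) (U i ω) (Finset.range i) (fun l => U l ω) ^ (2 * α) ∂P +
          2 * ∫ ω, (∑ j ∈ Finset.Ioo i n, edgeGain α i j fun l => U l ω) ^ 2 ∂P := by
        rw [integral_add (i1.const_mul 2) (i2.const_mul 2), integral_const_mul, integral_const_mul]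
    _ ≤ 2 * (momentConst d (2 * α) * ((i : ℝ) + 1) ^ (-(2 * α / d))) +
          2 * (((pairConst d α / (α / d)) ^ 2 + pairConst d (2 * α) / (2 * α / d)) *
            ((i : ℝ) + 1) ^ (-(2 * α / d))) := by
        gcongr
        · exact hU.integral_capDist_rpow_le hd i (by positivity)
        · exact hU.integral_sq_sum_edgeGain_le hd hα hαd n i
    _ = _ := by rw [deletionConst]; ring

lemma abs_capLength_le {α : ℝ} (hα : 0 ≤ α) (n : ℕ) (x : ℕ → EuclideanSpace ℝ (Fin d)) :
    |capLength α n x| ≤ √d ^ α * n := by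
  rw [abs_of_nonneg (capLength_nonneg ..)]; exact capLength_le hα n x

lemma IsUniformSequence.variance_capLength_le (hd : 1 ≤ d) (hU : IsUniformSequence U P)
    {α : ℝ} (hα : 0 < α) (hαd : α ≤ d / 2) (n : ℕ) :
    variance (fun ω => capLength α n fun l => U l ω) P ≤
      deletionConst d α * ∑ i ∈ Finset.range n, ((i : ℝ) + 1) ^ (-(2 * α / d)) := by
  rw [Finset.mul_sum]
  exact (hU.variance_le_sum n (measurable_capLength α n) (abs_capLength_le hα.le n)
    (fun i => measurable_capLengthErase α n i) (fun i => abs_capLengthErase_le hα.le n i)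
    (capLengthErase_update α n) (capLength_mask α n) (capLengthErase_mask α n)).trans
    (Finset.sum_le_sum fun i _ => hU.integral_sq_deletion_le hd hα hαd n i)

lemma IsUniformSequence.memLp_capLength (hU : IsUniformSequence U P) {α : ℝ} (hα : 0 ≤ α) (n : ℕ)
    {p : ENNReal} : MemLp (fun ω => capLength α n fun l => U l ω) p P :=
  memLp_of_bounded ((measurable_capLength α n).comp hU.measurable_seq)
    fun _ => abs_capLength_le hα n _

/-! ### The mean as a function of the number of points -/

lemma IsUniformSequence.abs_mean_sub_le (hd : 1 ≤ d) (hU : IsUniformSequence U P)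
    {α : ℝ} (hα : 0 < α) (hαd : α ≤ d / 2) (n k : ℕ) (hk : 1 ≤ k) :
    |∫ ω, capLength α n (fun l => U l ω) ∂P - ∫ ω, capLength α k (fun l => U l ω) ∂P| ≤
      2 * momentConst d α * |(n : ℝ) - k| * (k : ℝ) ^ (-(α / d)) := by
  have hdR : (0 : ℝ) < d := by exact_mod_cast hd
  set s := α / d with hs
  have hs0 : 0 < s := by positivity
  have hs1 : s ≤ 1 / 2 := by rw [hs, div_le_iff₀ hdR]; linarith
  have hM := momentConst_nonneg d hα.le
  have hi : ∀ m, Integrable (fun ω => capLength α m fun l => U l ω) P :=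
    fun m => (hU.memLp_capLength hα.le m (p := 1)).integrable le_rfl
  have hid : ∀ j, Integrable (fun ω =>
      capDist (√d) (U j ω) (Finset.range j) (fun l => U l ω) ^ α) P := fun j =>
    (memLp_of_bounded (B := √d ^ α) (p := 1)
      (((measurable_capDist_apply j _).pow_const α).comp hU.measurable_seq) fun ω => by
        have := capDist_rpow_le hα.le (U j ω) (Finset.range j) fun l => U l ω
        simpa [abs_of_nonneg (capDist_rpow_nonneg ..)] using this).integrable le_rfl
  have key : ∀ a b : ℕ, a ≤ b →
      |∫ ω, capLength α b (fun l => U l ω) ∂P - ∫ ω, capLength α a (fun l => U l ω) ∂P| ≤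
        2 * momentConst d α * ((b : ℝ) - a) * (b : ℝ) ^ (-s) := by
    intro a b hab
    have hba : (0 : ℝ) ≤ (b : ℝ) - a := sub_nonneg.2 (by exact_mod_cast hab)
    rw [← integral_sub (hi b) (hi a)]
    have hdiff : ∀ x : ℕ → EuclideanSpace ℝ (Fin d), capLength α b x - capLength α a x =
        ∑ j ∈ Finset.Ico (max 1 a) b, capDist (√d) (x j) (Finset.range j) x ^ α := by
      intro x
      unfold capLength
      rcases Nat.eq_zero_or_pos a with rfl | ha
      · simp
      · rw [max_eq_right ha, ← Finset.sum_Ico_consecutive _ ha hab]; ring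
    simp_rw [hdiff]
    rw [integral_finsetSum _ fun j _ => hid j, abs_of_nonneg (Finset.sum_nonneg fun j _ =>
      integral_nonneg fun ω => capDist_rpow_nonneg ..)]
    calc ∑ j ∈ Finset.Ico (max 1 a) b,
          ∫ ω, capDist (√d) (U j ω) (Finset.range j) (fun l => U l ω) ^ α ∂P
        ≤ ∑ j ∈ Finset.Ico (max 1 a) b, momentConst d α * ((j : ℝ) + 1) ^ (-s) :=
          Finset.sum_le_sum fun j _ => hU.integral_capDist_rpow_le hd j hα
      _ ≤ ∑ j ∈ Finset.Ico a b, momentConst d α * ((j : ℝ) + 1) ^ (-s) :=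
          Finset.sum_le_sum_of_subset_of_nonneg
            (Finset.Ico_subset_Ico_left (le_max_right _ _)) fun _ _ _ => by positivity
      _ ≤ momentConst d α * (((b : ℝ) - a) * (b : ℝ) ^ (-s) / (1 - s)) := by
          rw [← Finset.mul_sum]
          exact mul_le_mul_of_nonneg_left (sum_Ico_rpow_neg_le_mul hs0.le (by linarith) hab) hM
      _ ≤ momentConst d α * (((b : ℝ) - a) * (b : ℝ) ^ (-s) * 2) := by
          gcongr
          rw [div_le_iff₀ (by linarith)]
          have : 0 ≤ ((b : ℝ) - a) * (b : ℝ) ^ (-s) := by positivity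
          nlinarith
      _ = _ := by ring
  rcases le_total n k with h | h
  · rw [abs_sub_comm, abs_sub_comm (n : ℝ), abs_of_nonneg (sub_nonneg.2
      (Nat.cast_le.2 h) : (0 : ℝ) ≤ (k : ℝ) - n)]
    exact key n k h
  · have hnk : (0 : ℝ) ≤ (n : ℝ) - k := sub_nonneg.2 (Nat.cast_le.2 h)
    rw [abs_of_nonneg hnk]
    refine (key k n h).trans ?_
    gcongr ?_ * ?_
    exact Real.rpow_le_rpow_of_nonpos (by exact_mod_cast hk) (by exact_mod_cast h) (by linarith)

end Variance

/-! ### Moments of the Poisson distribution -/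

section Poisson

lemma hasSum_poisson_mul_id (r : ℝ≥0) :
    HasSum (fun n : ℕ => Real.exp (-r) * (r : ℝ) ^ n / n.factorial * n) r := by
  rw [← hasSum_nat_add_iff' 1]
  have h := (hasSum_one_poissonMeasure r).mul_left (r : ℝ)
  simp only [Finset.range_one, Finset.sum_singleton, Nat.cast_zero, mul_zero, sub_zero]
  rw [mul_one] at h
  refine h.congr_fun fun n => ?_
  rw [Nat.factorial_succ, pow_succ]
  push_cast
  field_simp

lemma hasSum_poisson_mul_sq (r : ℝ≥0) :
    HasSum (fun n : ℕ => Real.exp (-r) * (r : ℝ) ^ n / n.factorial * (n : ℝ) ^ 2)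
      (r * (r + 1)) := by
  rw [← hasSum_nat_add_iff' 1]
  have h := ((hasSum_poisson_mul_id r).add (hasSum_one_poissonMeasure r)).mul_left (r : ℝ)
  simp only [Finset.range_one, Finset.sum_singleton, Nat.cast_zero, ne_eq, OfNat.ofNat_ne_zero,
    not_false_eq_true, zero_pow, mul_zero, sub_zero]
  refine h.congr_fun fun n => ?_
  rw [Nat.factorial_succ, pow_succ]
  push_cast
  field_simp

lemma integrable_natCast_poissonMeasure (r : ℝ≥0) :
    Integrable (fun n : ℕ => (n : ℝ)) (poissonMeasure r) := by
  rw [integrable_poissonMeasure_iff]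
  simpa using (hasSum_poisson_mul_id r).summable

lemma integrable_natCast_sq_poissonMeasure (r : ℝ≥0) :
    Integrable (fun n : ℕ => (n : ℝ) ^ 2) (poissonMeasure r) := by
  rw [integrable_poissonMeasure_iff]
  simpa using (hasSum_poisson_mul_sq r).summable

lemma integral_natCast_poissonMeasure (r : ℝ≥0) : ∫ n : ℕ, (n : ℝ) ∂poissonMeasure r = r := by
  rw [integral_poissonMeasure]
  exact (hasSum_poisson_mul_id r).tsum_eq

lemma integral_natCast_sq_poissonMeasure (r : ℝ≥0) :
    ∫ n : ℕ, (n : ℝ) ^ 2 ∂poissonMeasure r = r * (r + 1) := by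
  rw [integral_poissonMeasure]
  exact (hasSum_poisson_mul_sq r).tsum_eq

lemma integrable_sub_sq_poissonMeasure (r : ℝ≥0) :
    Integrable (fun n : ℕ => ((n : ℝ) - r) ^ 2) (poissonMeasure r) := by
  have := ((integrable_natCast_sq_poissonMeasure r).sub
    ((integrable_natCast_poissonMeasure r).const_mul (2 * r))).add (integrable_const ((r : ℝ) ^ 2))
  refine this.congr (Filter.Eventually.of_forall fun n => ?_)
  simp only [Pi.add_apply, Pi.sub_apply]
  ring

lemma integral_sub_sq_poissonMeasure (r : ℝ≥0) :
    ∫ n : ℕ, ((n : ℝ) - r) ^ 2 ∂poissonMeasure r = r := by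
  have h2 := integrable_natCast_sq_poissonMeasure r
  have h1 := integrable_natCast_poissonMeasure r
  have h3 : Integrable (fun n : ℕ => (n : ℝ) ^ 2 - 2 * r * n) (poissonMeasure r) :=
    h2.sub (h1.const_mul _)
  have : ∀ n : ℕ, ((n : ℝ) - r) ^ 2 = (n : ℝ) ^ 2 - 2 * r * n + (r : ℝ) ^ 2 := fun n => by ring
  simp_rw [this]
  rw [integral_add h3 (integrable_const _), integral_sub h2 (h1.const_mul _), integral_const_mul,
    integral_natCast_poissonMeasure, integral_natCast_sq_poissonMeasure]
  simp
  ring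

lemma IsPoissonCountingProcess.map_eq {Ω : Type*} [MeasurableSpace Ω] {P : Measure Ω}
    {N : ℝ≥0 → Ω → ℕ} (hN : IsPoissonCountingProcess N P) (t : ℝ≥0) :
    P.map (N t) = poissonMeasure t := by
  have h := (hN.law 0 t zero_le).map_eq
  rw [tsub_zero] at h
  rw [← h]
  refine Measure.map_congr ?_
  filter_upwards [hN.zero] with ω hω
  simp [hω]

lemma memLp_natCast_of_map_eq_poissonMeasure {Ω : Type*} [MeasurableSpace Ω]
    {P : Measure Ω} {M : Ω → ℕ} (hM : Measurable M) {r : ℝ≥0}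
    (hlaw : P.map M = poissonMeasure r) : MemLp (fun ω => (M ω : ℝ)) 2 P := by
  have hMr : Measurable fun ω => (M ω : ℝ) := (measurable_of_countable _).comp hM
  refine (memLp_two_iff_integrable_sq hMr.aestronglyMeasurable).2 ?_
  have h := integrable_natCast_sq_poissonMeasure r
  rw [← hlaw] at h
  exact h.comp_measurable hM

end Poisson

/-! ### Comparison with the total length of the on-line nearest-neighbour graph -/

section Comparison

variable {d : ℕ}

lemma nnDist_eq_capDist {x : ℕ → EuclideanSpace ℝ (Fin d)} (hx : ∀ i, x i ∈ unitCube d)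
    (hinj : ∀ i j, i ≠ j → x i ≠ x j) {i : ℕ} (hi : 1 ≤ i) :
    nnDist (x i) (x '' Set.Iio i) = capDist (√d) (x i) (Finset.range i) x := by
  have hS : x '' Set.Iio i \ {x i} = x '' Set.Iio i := by
    refine Set.sdiff_singleton_eq_self ?_
    rintro ⟨j, hj, he⟩
    exact hinj j i (ne_of_lt hj) he
  rw [nnDist, hS]
  apply le_antisymm
  · refine le_capDist.2 ⟨?_, fun l hl => ?_⟩
    · exact (Metric.infDist_le_dist_of_mem (Set.mem_image_of_mem x (Set.mem_Iio.2 hi))).trans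
        (dist_le_sqrt_of_mem_unitCube (hx i) (hx 0))
    · exact Metric.infDist_le_dist_of_mem (Set.mem_image_of_mem x (Finset.mem_range.1 hl))
  · refine (Metric.le_infDist (Set.Nonempty.image x ⟨0, Set.mem_Iio.2 hi⟩)).2 ?_
    rintro _ ⟨l, hl, rfl⟩
    exact capDist_le_dist _ _ _ (Finset.mem_range.2 hl)

lemma totalLength_eq_capLength {x : ℕ → EuclideanSpace ℝ (Fin d)} (hx : ∀ i, x i ∈ unitCube d)
    (hinj : ∀ i j, i ≠ j → x i ≠ x j) (α : ℝ) (n : ℕ) : totalLength α x n = capLength α n x :=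
  Finset.sum_congr rfl fun i hi => by
    rw [nnDist_eq_capDist hx hinj (Finset.mem_Ico.1 hi).1]

end Comparison

section RandomLength

variable {Ω : Type*} [MeasurableSpace Ω] {P : Measure Ω} {d : ℕ}
  {U : ℕ → Ω → EuclideanSpace ℝ (Fin d)}

lemma measurable_capLength_uncurry (α : ℝ) :
    Measurable fun p : ℕ × (ℕ → EuclideanSpace ℝ (Fin d)) => capLength α p.1 p.2 :=
  measurable_from_prod_countable_right fun n => measurable_capLength α n

lemma IsUniformSequence.memLp_capLength_random (hU : IsUniformSequence U P) {α : ℝ} (hα : 0 ≤ α)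
    {M : Ω → ℕ} (hM : Measurable M) {r : ℝ≥0} (hlaw : P.map M = poissonMeasure r) :
    MemLp (fun ω => capLength α (M ω) fun l => U l ω) 2 P := by
  have hM2 := memLp_natCast_of_map_eq_poissonMeasure hM hlaw
  have hpair : Measurable fun ω => (M ω, fun l => U l ω) := hM.prodMk hU.measurable_seq
  have hmeas := (measurable_capLength_uncurry (d := d) α).comp hpair
  simp only [Function.comp_def] at hmeas
  have hM3 : MemLp (fun ω => √d ^ α * (M ω : ℝ)) 2 P := hM2.const_mul (√d ^ α)
  refine hM3.mono' hmeas.aestronglyMeasurable (Filter.Eventually.of_forall fun ω => ?_)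
  rw [Real.norm_eq_abs]
  exact abs_capLength_le hα (M ω) fun l => U l ω

end RandomLength

section Main

variable {Ω : Type*} [MeasurableSpace Ω] {P : Measure Ω} [IsProbabilityMeasure P] {d : ℕ}
  {U : ℕ → Ω → EuclideanSpace ℝ (Fin d)}

lemma variance_centred {X : Ω → ℝ} (hX : AEStronglyMeasurable X P) :
    variance (centred P X) P = variance X P :=
  variance_sub_const hX _

lemma IsUniformSequence.binomialLength_ae_eq (hd : 1 ≤ d) (hU : IsUniformSequence U P) (α : ℝ)
    (n : ℕ) : binomialLength α U n =ᵐ[P] fun ω => capLength α n fun l => U l ω := by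
  filter_upwards [hU.ae_mem, hU.ae_injective hd] with ω h1 h2
  exact totalLength_eq_capLength h1 h2 α n

lemma IsUniformSequence.poissonLength_ae_eq (hd : 1 ≤ d) (hU : IsUniformSequence U P) (α : ℝ)
    (N : ℝ≥0 → Ω → ℕ) (t : ℝ≥0) :
    poissonLength α U N t =ᵐ[P] fun ω => capLength α (N t ω) fun l => U l ω := by
  filter_upwards [hU.ae_mem, hU.ae_injective hd] with ω h1 h2
  exact totalLength_eq_capLength h1 h2 α (N t ω)

/-- The constant in the variance bounds. -/
def varConst (d : ℕ) (α : ℝ) : ℝ := 2 * deletionConst d α + 16 * momentConst d α ^ 2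

lemma IsUniformSequence.binomial_bound (hd : 1 ≤ d) (hU : IsUniformSequence U P)
    {α : ℝ} (hα : 0 < α) (hαd : α ≤ d / 2) {n : ℕ} (hn : 1 ≤ n) {v : ℝ}
    (hv : ∑ i ∈ Finset.range n, ((i : ℝ) + 1) ^ (-(2 * α / d)) ≤ v * (1 + n / (n : ℝ))) :
    MemLp (binomialLength α U n) 2 P ∧
      variance (centred P (binomialLength α U n)) P ≤ varConst d α * v := by
  have hae := hU.binomialLength_ae_eq hd α n
  have hmem : MemLp (binomialLength α U n) 2 P :=
    (memLp_congr_ae hae).2 (hU.memLp_capLength hα.le n)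
  refine ⟨hmem, ?_⟩
  have hn0 : (n : ℝ) ≠ 0 := by exact_mod_cast (by omega)
  rw [div_self hn0] at hv
  have hA := deletionConst_nonneg d hα.le
  have hv0 : 0 ≤ v := by
    have : (0 : ℝ) ≤ ∑ i ∈ Finset.range n, ((i : ℝ) + 1) ^ (-(2 * α / d)) :=
      Finset.sum_nonneg fun _ _ => by positivity
    linarith
  rw [variance_centred hmem.aestronglyMeasurable, variance_congr hae]
  calc _ ≤ _ := hU.variance_capLength_le hd hα hαd n
    _ ≤ deletionConst d α * (v * (1 + 1)) := mul_le_mul_of_nonneg_left hv hA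
    _ ≤ _ := by
      rw [varConst]
      nlinarith [mul_nonneg (sq_nonneg (momentConst d α)) hv0]

lemma IsUniformSequence.variance_capLength_random_le (hd : 1 ≤ d) (hU : IsUniformSequence U P)
    {α : ℝ} (hα : 0 < α) (hαd : α ≤ d / 2) {M : Ω → ℕ} (hM : Measurable M)
    (hind : IndepFun M (fun ω l => U l ω) P) {r : ℝ≥0} (hr : 1 ≤ r)
    (hlaw : P.map M = poissonMeasure r) {v : ℝ}
    (hv : ∀ n : ℕ, ∑ i ∈ Finset.range n, ((i : ℝ) + 1) ^ (-(2 * α / d)) ≤ v * (1 + n / (r : ℝ)))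
    (hv' : (r : ℝ) ^ (1 - 2 * α / d) ≤ v) :
    variance (fun ω => capLength α (M ω) fun l => U l ω) P ≤ varConst d α * v := by
  have hr1 : (1 : ℝ) ≤ r := by exact_mod_cast hr
  have hr0 : (0 : ℝ) < r := by linarith
  have hmem := hU.memLp_capLength_random hα.le hM hlaw
  have hA := deletionConst_nonneg d hα.le
  set m : ℕ → ℝ := fun n => ∫ ω, capLength α n (fun l => U l ω) ∂P with hm
  set k := ⌈(r : ℝ)⌉₊ with hk
  have hkr : (r : ℝ) ≤ k := Nat.le_ceil _
  have hkr' : (k : ℝ) < r + 1 := Nat.ceil_lt_add_one hr0.le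
  have hk1 : 1 ≤ k := by
    have : (0 : ℝ) < k := by linarith
    exact_mod_cast this
  set w : ℝ := (r : ℝ) ^ (-(2 * α / d)) with hw
  have hw0 : 0 ≤ w := by positivity
  set B : ℝ := 4 * momentConst d α ^ 2 with hB
  have hB0 : 0 ≤ B := by positivity
  have hinner : ∀ n : ℕ, ∫ ω, (capLength α n (fun l => U l ω) - m k) ^ 2 ∂P ≤
      deletionConst d α * (v * (1 + n / (r : ℝ))) + B * w * (2 * ((n : ℝ) - r) ^ 2 + 2) := by
    intro n
    rw [integral_sub_const_sq (hU.memLp_capLength hα.le n)]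
    refine add_le_add ((hU.variance_capLength_le hd hα hαd n).trans
      (mul_le_mul_of_nonneg_left (hv n) hA)) ?_
    have h1 := hU.abs_mean_sub_le hd hα hαd n k hk1
    rw [← sq_abs]
    calc _ ≤ (2 * momentConst d α * |(n : ℝ) - k| * (k : ℝ) ^ (-(α / d))) ^ 2 :=
          pow_le_pow_left₀ (abs_nonneg _) h1 2
      _ = B * (((k : ℝ) ^ (-(α / d))) ^ 2 * ((n : ℝ) - k) ^ 2) := by
          rw [mul_pow, mul_pow, sq_abs, hB]; ring
      _ ≤ B * (w * (2 * ((n : ℝ) - r) ^ 2 + 2)) := by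
          gcongr
          · rw [← Real.rpow_natCast, ← Real.rpow_mul (by positivity), hw]
            have : -(α / d) * ((2 : ℕ) : ℝ) = -(2 * α / d) := by push_cast; ring
            rw [this]
            exact Real.rpow_le_rpow_of_nonpos hr0 hkr (by
              have : 0 ≤ 2 * α / d := by positivity
              linarith)
          · nlinarith [sq_nonneg (((n : ℝ) - r) + (k - r)), sq_nonneg ((k : ℝ) - r)]
      _ = _ := by ring
  have hgi : Integrable (fun n : ℕ => deletionConst d α * (v * (1 + n / (r : ℝ))) +
      B * w * (2 * ((n : ℝ) - r) ^ 2 + 2)) (poissonMeasure r) :=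
    ((((integrable_const (1 : ℝ)).add ((integrable_natCast_poissonMeasure r).div_const
      _)).const_mul _).const_mul _).add
      ((((integrable_sub_sq_poissonMeasure r).const_mul 2).add (integrable_const 2)).const_mul _)
  have hgint : ∫ n : ℕ, (deletionConst d α * (v * (1 + n / (r : ℝ))) +
      B * w * (2 * ((n : ℝ) - r) ^ 2 + 2)) ∂poissonMeasure r =
        deletionConst d α * (v * 2) + B * w * (2 * r + 2) := by
    have i1 := (integrable_natCast_poissonMeasure r).div_const (r : ℝ)
    have i2 := (integrable_sub_sq_poissonMeasure r).const_mul 2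
    have i3 : Integrable (fun n : ℕ => 1 + (n : ℝ) / r) (poissonMeasure r) :=
      (integrable_const (1 : ℝ)).add i1
    have i4 : Integrable (fun n : ℕ => 2 * ((n : ℝ) - r) ^ 2 + 2) (poissonMeasure r) :=
      i2.add (integrable_const (2 : ℝ))
    rw [integral_add ((i3.const_mul _).const_mul _) (i4.const_mul _), integral_const_mul,
      integral_const_mul, integral_const_mul, integral_add (integrable_const _) i1,
      integral_add i2 (integrable_const _), integral_const_mul, integral_div,
      integral_natCast_poissonMeasure, integral_sub_sq_poissonMeasure, div_self hr0.ne']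
    simp
    norm_num
  have hsq : Integrable (fun ω => (capLength α (M ω) (fun l => U l ω) - m k) ^ 2) P :=
    (hmem.sub (memLp_const (m k))).integrable_sq
  have hmsq : Measurable fun p : ℕ × (ℕ → EuclideanSpace ℝ (Fin d)) =>
      (capLength α p.1 p.2 - m k) ^ 2 :=
    ((measurable_capLength_uncurry α).sub_const _).pow_const 2
  have hpair : Measurable fun ω => (M ω, fun l => U l ω) := hM.prodMk hU.measurable_seq
  have hmap : P.map (fun ω => (M ω, fun l => U l ω)) =
      (poissonMeasure r).prod (P.map fun ω l => U l ω) := by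
    rw [← hlaw]
    exact hind.map_prod_eq_prod_map_map hM.aemeasurable hU.measurable_seq.aemeasurable
  have : IsProbabilityMeasure (P.map fun ω l => U l ω) :=
    Measure.isProbabilityMeasure_map hU.measurable_seq.aemeasurable
  have hprodint : Integrable (fun p : ℕ × (ℕ → EuclideanSpace ℝ (Fin d)) =>
      (capLength α p.1 p.2 - m k) ^ 2) ((poissonMeasure r).prod (P.map fun ω l => U l ω)) := by
    rw [← hmap, integrable_map_measure hmsq.aestronglyMeasurable hpair.aemeasurable]
    exact hsq
  calc variance (fun ω => capLength α (M ω) fun l => U l ω) P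
      ≤ ∫ ω, (capLength α (M ω) (fun l => U l ω) - m k) ^ 2 ∂P := by
        rw [integral_sub_const_sq hmem]
        exact le_add_of_nonneg_right (sq_nonneg _)
    _ = ∫ p, (capLength α p.1 p.2 - m k) ^ 2
          ∂((poissonMeasure r).prod (P.map fun ω l => U l ω)) := by
        rw [← hmap, integral_map hpair.aemeasurable hmsq.aestronglyMeasurable]
    _ = ∫ n, ∫ ω, (capLength α n (fun l => U l ω) - m k) ^ 2 ∂P ∂poissonMeasure r := by
        rw [integral_prod _ hprodint]
        refine integral_congr_ae (Filter.Eventually.of_forall fun n => ?_)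
        exact integral_map hU.measurable_seq.aemeasurable
          (hmsq.comp measurable_prodMk_left).aestronglyMeasurable
    _ ≤ ∫ n : ℕ, (deletionConst d α * (v * (1 + n / (r : ℝ))) +
          B * w * (2 * ((n : ℝ) - r) ^ 2 + 2)) ∂poissonMeasure r :=
        integral_mono_of_nonneg (Filter.Eventually.of_forall fun n =>
          integral_nonneg fun ω => sq_nonneg _) hgi (Filter.Eventually.of_forall hinner)
    _ = deletionConst d α * (v * 2) + B * w * (2 * r + 2) := hgint
    _ ≤ deletionConst d α * (v * 2) + B * (4 * v) := by
        have hwr : w * r ≤ v := by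
          rw [sub_eq_add_neg, Real.rpow_add hr0, Real.rpow_one] at hv'
          linarith
        have hwv : w * (2 * r + 2) ≤ 4 * v := by nlinarith
        rw [mul_assoc]
        gcongr
    _ = varConst d α * v := by rw [varConst, hB]; ring

lemma IsUniformSequence.poisson_bound (hd : 1 ≤ d) (hU : IsUniformSequence U P)
    {α : ℝ} (hα : 0 < α) (hαd : α ≤ d / 2) {N : ℝ≥0 → Ω → ℕ}
    (hN : IsPoissonCountingProcess N P) (hind : IndepFun (fun ω t => N t ω) (fun ω i => U i ω) P)
    {r : ℝ≥0} (hr : 1 ≤ r) {v : ℝ}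
    (hv : ∀ n : ℕ, ∑ i ∈ Finset.range n, ((i : ℝ) + 1) ^ (-(2 * α / d)) ≤ v * (1 + n / (r : ℝ)))
    (hv' : (r : ℝ) ^ (1 - 2 * α / d) ≤ v) :
    MemLp (poissonLength α U N r) 2 P ∧
      variance (centred P (poissonLength α U N r)) P ≤ varConst d α * v := by
  have hae := hU.poissonLength_ae_eq hd α N r
  have hmem : MemLp (poissonLength α U N r) 2 P :=
    (memLp_congr_ae hae).2 (hU.memLp_capLength_random hα.le (hN.measurable r) (hN.map_eq r))
  refine ⟨hmem, ?_⟩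
  rw [variance_centred hmem.aestronglyMeasurable, variance_congr hae]
  exact hU.variance_capLength_random_le hd hα hαd (hN.measurable r)
    (hind.comp (measurable_pi_apply r) measurable_id) hr (hN.map_eq r) hv hv'

end Main

/-! ### Growth of the bounds -/

lemma sum_rpow_neg_le_growth {t : ℝ} (ht : 0 ≤ t) (ht' : t < 1) {r : ℝ} (hr : 1 ≤ r) (n : ℕ) :
    ∑ i ∈ Finset.range n, ((i : ℝ) + 1) ^ (-t) ≤ 1 / (1 - t) * r ^ (1 - t) * (1 + n / r) := by
  have hr0 : 0 < r := by linarith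
  have h1 := sum_Ico_rpow_neg_le ht ht' (Nat.zero_le n)
  rw [Nat.Ico_zero_eq_range, Nat.cast_zero, Real.zero_rpow (by linarith), sub_zero] at h1
  have h2 : (n : ℝ) ^ (1 - t) ≤ r ^ (1 - t) * (1 + n / r) := by
    have h3 : ((n : ℝ) / r) ^ (1 - t) ≤ 1 + n / r :=
      calc ((n : ℝ) / r) ^ (1 - t) ≤ (1 + n / r) ^ (1 - t) :=
            Real.rpow_le_rpow (by positivity) (by linarith) (by linarith)
        _ ≤ (1 + n / r) ^ (1 : ℝ) :=
            Real.rpow_le_rpow_of_exponent_le (le_add_of_nonneg_right (by positivity)) (by linarith)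
        _ = _ := Real.rpow_one _
    calc (n : ℝ) ^ (1 - t) = (r * (n / r)) ^ (1 - t) := by rw [mul_div_cancel₀ _ hr0.ne']
      _ = r ^ (1 - t) * (n / r) ^ (1 - t) := Real.mul_rpow hr0.le (by positivity)
      _ ≤ _ := by gcongr
  calc _ ≤ _ := h1
    _ ≤ r ^ (1 - t) * (1 + n / r) / (1 - t) := div_le_div_of_nonneg_right h2 (by linarith)
    _ = _ := by ring

lemma one_le_log_growth {r : ℝ} (hr : 1 ≤ r) :
    1 + Real.log (1 + r) ≤ (1 + 1 / Real.log 2) * Real.log (1 + r) := by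
  have h2 : 0 < Real.log 2 := Real.log_pos (by norm_num)
  have hlog : Real.log 2 ≤ Real.log (1 + r) := Real.log_le_log (by norm_num) (by linarith)
  have : 1 ≤ 1 / Real.log 2 * Real.log (1 + r) := by
    rw [one_div, inv_mul_eq_div, one_le_div h2]; exact hlog
  linarith

lemma sum_rpow_neg_one_le_growth {r : ℝ} (hr : 1 ≤ r) (n : ℕ) :
    ∑ i ∈ Finset.range n, ((i : ℝ) + 1) ^ (-1 : ℝ) ≤
      (1 + 1 / Real.log 2) * Real.log (1 + r) * (1 + n / r) := by
  have hr0 : 0 < r := by linarith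
  have hlog : 0 ≤ Real.log (1 + r) := Real.log_nonneg (by linarith)
  have h1 : ∑ i ∈ Finset.range n, ((i : ℝ) + 1) ^ (-1 : ℝ) ≤ 1 + Real.log n := by
    refine le_trans (le_of_eq ?_) (harmonic_le_one_add_log n)
    rw [harmonic]
    push_cast
    exact Finset.sum_congr rfl fun i _ => Real.rpow_neg_one _
  have h2 : Real.log n ≤ Real.log (1 + r) + n / r := by
    rcases Nat.eq_zero_or_pos n with rfl | hn
    · simpa using hlog
    have hn' : (0 : ℝ) < n := by exact_mod_cast hn
    have h3 := Real.log_le_sub_one_of_pos (show 0 < (n : ℝ) / (1 + r) by positivity)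
    rw [Real.log_div hn'.ne' (by positivity)] at h3
    have h4 : (n : ℝ) / (1 + r) ≤ n / r := by gcongr; linarith
    linarith
  have h5 := one_le_log_growth hr
  have h6 : 0 ≤ (n : ℝ) / r := by positivity
  nlinarith

end OnlineNN

end

theorem theorem2p1 (d : ℕ) (hd : 1 ≤ d) :
    (∀ α : ℝ, 0 < α → α < (d : ℝ) / 2 →
      ∃ C : ℝ, 0 < C ∧
        ∀ (Ω : Type*) [MeasurableSpace Ω] (P : Measure Ω) [IsProbabilityMeasure P]
          (U : ℕ → Ω → EuclideanSpace ℝ (Fin d)), OnlineNN.IsUniformSequence U P →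
          (∀ n : ℕ, 1 ≤ n →
            MemLp (OnlineNN.binomialLength α U n) 2 P ∧
            variance (OnlineNN.centred P (OnlineNN.binomialLength α U n)) P
              ≤ C * (n : ℝ) ^ (1 - 2 * α / (d : ℝ))) ∧
          (∀ N : ℝ≥0 → Ω → ℕ, OnlineNN.IsPoissonCountingProcess N P →
            IndepFun (fun ω t => N t ω) (fun ω i => U i ω) P →
            ∀ lam : ℝ≥0, 1 ≤ lam →
              MemLp (OnlineNN.poissonLength α U N lam) 2 P ∧
              variance (OnlineNN.centred P (OnlineNN.poissonLength α U N lam)) P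
                ≤ C * (lam : ℝ) ^ (1 - 2 * α / (d : ℝ)))) ∧
    (∃ C : ℝ, 0 < C ∧
        ∀ (Ω : Type*) [MeasurableSpace Ω] (P : Measure Ω) [IsProbabilityMeasure P]
          (U : ℕ → Ω → EuclideanSpace ℝ (Fin d)), OnlineNN.IsUniformSequence U P →
          (∀ n : ℕ, 1 ≤ n →
            MemLp (OnlineNN.binomialLength ((d : ℝ) / 2) U n) 2 P ∧
            variance (OnlineNN.centred P (OnlineNN.binomialLength ((d : ℝ) / 2) U n)) P
              ≤ C * Real.log (1 + (n : ℝ))) ∧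
          (∀ N : ℝ≥0 → Ω → ℕ, OnlineNN.IsPoissonCountingProcess N P →
            IndepFun (fun ω t => N t ω) (fun ω i => U i ω) P →
            ∀ lam : ℝ≥0, 1 ≤ lam →
              MemLp (OnlineNN.poissonLength ((d : ℝ) / 2) U N lam) 2 P ∧
              variance (OnlineNN.centred P (OnlineNN.poissonLength ((d : ℝ) / 2) U N lam)) P
                ≤ C * Real.log (1 + (lam : ℝ)))) := by
  have hdR : (0 : ℝ) < d := by exact_mod_cast hd
  constructor
  · intro α hα hαd
    have ht : 2 * α / d < 1 := by rw [div_lt_one hdR]; linarith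
    have ht0 : 0 ≤ 2 * α / d := by positivity
    have hK : 1 ≤ 1 / (1 - 2 * α / d) := by
      rw [one_le_div (by linarith)]; linarith
    have hV : 0 ≤ OnlineNN.varConst d α :=
      add_nonneg (mul_nonneg zero_le_two (OnlineNN.deletionConst_nonneg d hα.le)) (by positivity)
    have hle : ∀ {r : ℝ}, 1 ≤ r → OnlineNN.varConst d α *
        (1 / (1 - 2 * α / d) * r ^ (1 - 2 * α / d)) ≤
          (OnlineNN.varConst d α * (1 / (1 - 2 * α / d)) + 1) * r ^ (1 - 2 * α / d) := by
      intro r hr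
      have : 0 ≤ r ^ (1 - 2 * α / d) := by positivity
      linarith
    refine ⟨OnlineNN.varConst d α * (1 / (1 - 2 * α / d)) + 1, by positivity, ?_⟩
    intro Ω _ P _ U hU
    refine ⟨fun n hn => ?_, fun N hN hind r hr => ?_⟩
    · have hn' : (1 : ℝ) ≤ n := by exact_mod_cast hn
      obtain ⟨h1, h2⟩ := hU.binomial_bound hd hα hαd.le hn
        (OnlineNN.sum_rpow_neg_le_growth ht0 ht hn' n)
      exact ⟨h1, h2.trans (hle hn')⟩
    · have hr' : (1 : ℝ) ≤ r := by exact_mod_cast hr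
      obtain ⟨h1, h2⟩ := hU.poisson_bound hd hα hαd.le hN hind hr
        (OnlineNN.sum_rpow_neg_le_growth ht0 ht hr')
        (le_mul_of_one_le_left (by positivity) hK)
      exact ⟨h1, h2.trans (hle hr')⟩
  · have hα : 0 < (d : ℝ) / 2 := by positivity
    have ht : 2 * ((d : ℝ) / 2) / d = 1 := by field_simp
    have h2 : 0 < Real.log 2 := Real.log_pos (by norm_num)
    have hV : 0 ≤ OnlineNN.varConst d (d / 2) :=
      add_nonneg (mul_nonneg zero_le_two (OnlineNN.deletionConst_nonneg d hα.le)) (by positivity)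
    have hle : ∀ {r : ℝ}, 1 ≤ r → OnlineNN.varConst d (d / 2) *
        ((1 + 1 / Real.log 2) * Real.log (1 + r)) ≤
          (OnlineNN.varConst d (d / 2) * (1 + 1 / Real.log 2) + 1) * Real.log (1 + r) := by
      intro r hr
      have : 0 ≤ Real.log (1 + r) := Real.log_nonneg (by linarith)
      linarith
    refine ⟨OnlineNN.varConst d (d / 2) * (1 + 1 / Real.log 2) + 1, by positivity, ?_⟩
    intro Ω _ P _ U hU
    refine ⟨fun n hn => ?_, fun N hN hind r hr => ?_⟩
    · have hn' : (1 : ℝ) ≤ n := by exact_mod_cast hn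
      obtain ⟨h1, h2⟩ := hU.binomial_bound hd hα le_rfl hn
        (by rw [ht]; exact OnlineNN.sum_rpow_neg_one_le_growth hn' n)
      exact ⟨h1, h2.trans (hle hn')⟩
    · have hr' : (1 : ℝ) ≤ r := by exact_mod_cast hr
      have hlog : 0 ≤ Real.log (1 + (r : ℝ)) := Real.log_nonneg (by linarith)
      obtain ⟨h1, h2⟩ := hU.poisson_bound hd hα le_rfl hN hind hr
        (by rw [ht]; exact OnlineNN.sum_rpow_neg_one_le_growth hr')
        (by rw [ht, sub_self, Real.rpow_zero]; linarith [OnlineNN.one_le_log_growth hr'])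
      exact ⟨h1, h2.trans (hle hr')⟩
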